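/- For a metric space $X$, a cover $\mathcal U$ of $X$ is $D$-bounded if all its members have diameter at most $D$, and it has $r$-multiplicity at most $k$ if every subset of $X$ of diameter at most $r$ meets at most $k$ members of $\mathcal U$. The asymptotic dimension $\operatorname{asdim}(X)\in\mathbb N\cup\{\infty\}$ is the smallest $n$ such that for every $r>0$ there are $D<\infty$ and a $D$-bounded cover of $X$ of $r$-multiplicity at most $n+1$. The linearly controlled asymptotic dimension $\ell\text{-}\mathrm{asdim}(X)\in\mathbb N\cup\{\infty\}$ is the smallest $n$ for which there is $L<\infty$ such that for all sufficiently large $r$ there is an $Lr$-bounded cover of $X$ of $r$-multiplicity at most $n+1$. For a connected graph $\Gamma$ with vertex set $V$ and edge set $E$, the horoball $\mathcal H(\Gamma)$ is the metric graph with vertex set $V\times\mathbb N$, edges $((v,k),(v,k+1))$ of length $1$ for $v\in V$, $k\in\mathbb N$, and edges $((v,k),(v',k))$ of length $e^{-k}$ for $(v,v')\in E$, $k\in\mathbb N$. Let $G$ be a group and $H_1,\dots,H_n$ subgroups of $G$. Call a finite generating set $S$ of $G$ compatible if $S\cap H_i$ generates $H_i$ for every $i$. For such $S$ let $\Gamma(G,S)$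 be the Cayley graph, with edges of length one. The Bowditch space $X(G)=X(G,\{H_i\},S)$ is the metric graph, with its path metric, obtained by gluing to $\Gamma(G,S)$, for every $i$ and every left coset $gH_i$, a copy of $\mathcal H(\Gamma(H_i,S\cap H_i))$ along its part at height $0$, which is identified with the copy of $\Gamma(H_i,S\cap H_i)$ on $gH_i$. The group $G$ is hyperbolic relative to $H_1,\dots,H_n$ if $X(G,\{H_i\},S_0)$ is Gromov hyperbolic for some compatible finite generating set $S_0$. **Proposition.** Let $G$ be hyperbolic relative to $H_1,\dots,H_n$, let $S$ be any compatible finite generating set, and let $X(G)=X(G,\{H_i\},S)$. Equip $G$ and $H_i$ with the word metrics of $S$ and $S\cap H_i$, and let $m=\max_{1\le i\le n}\ell\text{-}\mathrm{asdim}(H_i)\in\mathbb N\cup\{\infty\}$ (with $m=0$ if $n=0$). Then $$\max\{\operatorname{asdim}(G),\,m\}\;\le\;\operatorname{asdim}(X(G))\;\le\;\max\{\operatorname{asdim}(G),\,m+1\}.$$ -/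

import Mathlib

open scoped ENNReal

namespace BowditchSpace

noncomputable section

/-! ## Asymptotic dimensions and hyperbolicity -/

section Coarse

variable {X : Type*} [PseudoEMetricSpace X]

/-- Every member of the family `𝒰` has diameter at most `D`. -/
def DiamBounded (𝒰 : Set (Set X)) (D : ℝ) : Prop :=
  ∀ U ∈ 𝒰, Metric.ediam U ≤ ENNReal.ofReal D

/-- The `r`-multiplicity of `𝒰` is at most `k`: every subset of diameter at most `r` meets at most
`k` members of `𝒰`. -/
def MultiplicityLE (𝒰 : Set (Set X)) (r : ℝ) (k : ℕ∞) : Prop :=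
  ∀ A : Set X, Metric.ediam A ≤ ENNReal.ofReal r → {U ∈ 𝒰 | (U ∩ A).Nonempty}.encard ≤ k

variable (X)

/-- The asymptotic dimension. -/
def asdim : ℕ∞ :=
  sInf {n : ℕ∞ | ∀ r : ℝ, 0 < r → ∃ D : ℝ, ∃ 𝒰 : Set (Set X),
    ⋃₀ 𝒰 = Set.univ ∧ DiamBounded 𝒰 D ∧ MultiplicityLE 𝒰 r (n + 1)}

/-- The linearly controlled asymptotic dimension. -/
def lasdim : ℕ∞ :=
  sInf {n : ℕ∞ | ∃ L : ℝ, ∃ r₀ : ℝ, ∀ r : ℝ, r₀ ≤ r → ∃ 𝒰 : Set (Set X),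
    ⋃₀ 𝒰 = Set.univ ∧ DiamBounded 𝒰 (L * r) ∧ MultiplicityLE 𝒰 r (n + 1)}

/-- Gromov hyperbolicity, by Gromov's four-point condition. -/
def IsGromovHyperbolic : Prop :=
  ∃ δ : ℝ, ∀ x y z w : X,
    edist x y + edist z w ≤
      max (edist x z + edist y w) (edist x w + edist y z) + ENNReal.ofReal δ

end Coarse

/-! ## Metric graphs -/

section MetricGraph

variable {V : Type*}

/-- The point at parameter `t ∈ [0, 1]` of the edge from `u` to `v`, in barycentric coordinates. -/
def edgePoint (u v : V) (t : ℝ) : V →₀ ℝ :=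
  Finsupp.single u (1 - t) + Finsupp.single v t

/-- The geometric realization of the graph `Γ`: all vertices and all points of edges, in
barycentric coordinates. The edge lengths `ℓ` enter through the path metric below. -/
def MetricGraph (Γ : SimpleGraph V) (_ℓ : V → V → ℝ) : Type _ :=
  {p : V →₀ ℝ // (∃ v, p = Finsupp.single v 1) ∨
    ∃ u v, Γ.Adj u v ∧ ∃ t ∈ Set.Icc (0 : ℝ) 1, p = edgePoint u v t}

/-- `PLPath Γ ℓ p q L`: there is a piecewise linear path of length `L` from `p` to `q` in the
realization of `Γ`, where the edge from `u` to `v` is an interval of length `ℓ u v`. -/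
inductive PLPath (Γ : SimpleGraph V) (ℓ : V → V → ℝ) : (V →₀ ℝ) → (V →₀ ℝ) → ℝ → Prop
  | nil (p : V →₀ ℝ) : PLPath Γ ℓ p p 0
  | cons {u v : V} (huv : Γ.Adj u v) {s t : ℝ} (hs : s ∈ Set.Icc (0 : ℝ) 1)
      (ht : t ∈ Set.Icc (0 : ℝ) 1) {q : V →₀ ℝ} {L : ℝ}
      (h : PLPath Γ ℓ (edgePoint u v t) q L) :
      PLPath Γ ℓ (edgePoint u v s) q (ℓ u v * |s - t| + L)

theorem PLPath.trans {Γ : SimpleGraph V} {ℓ : V → V → ℝ} {p q r : V →₀ ℝ} {L M : ℝ}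
    (h : PLPath Γ ℓ p q L) (h' : PLPath Γ ℓ q r M) : PLPath Γ ℓ p r (L + M) := by
  induction h with
  | nil p => simpa using h'
  | cons huv hs ht _ ih =>
    rw [add_assoc]
    exact PLPath.cons huv hs ht (ih h')

theorem PLPath.symm {Γ : SimpleGraph V} {ℓ : V → V → ℝ} {p q : V →₀ ℝ} {L : ℝ}
    (h : PLPath Γ ℓ p q L) : PLPath Γ ℓ q p L := by
  induction h with
  | nil p => exact PLPath.nil p
  | cons huv hs ht _ ih =>
    have h1 := ih.trans (PLPath.cons huv ht hs (PLPath.nil _))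
    rw [add_zero, abs_sub_comm, add_comm] at h1
    exact h1

/-- The path metric: the infimum of the lengths of the piecewise linear paths. -/
instance (Γ : SimpleGraph V) (ℓ : V → V → ℝ) : PseudoEMetricSpace (MetricGraph Γ ℓ) where
  edist p q := ⨅ (L : ℝ) (_ : PLPath Γ ℓ p.1 q.1 L), ENNReal.ofReal L
  edist_self p := le_antisymm
    ((iInf₂_le 0 (PLPath.nil p.1)).trans (by simp)) (zero_le)
  edist_comm p q := by
    refine le_antisymm ?_ ?_ <;>
    exact le_iInf₂ fun L hL => iInf₂_le L hL.symm
  edist_triangle p q r := by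
    rw [ENNReal.iInf_add]
    refine le_iInf fun L => ?_
    rw [ENNReal.iInf_add]
    refine le_iInf fun hL => ?_
    rw [ENNReal.add_iInf]
    refine le_iInf fun M => ?_
    rw [ENNReal.add_iInf]
    refine le_iInf fun hM => ?_
    exact (iInf₂_le (L + M) (hL.trans hM)).trans ENNReal.ofReal_add_le

/-- The graph underlying the horoball over `Γ`, with vertex set `V × ℕ`. -/
def horoballGraph (Γ : SimpleGraph V) : SimpleGraph (V × ℕ) where
  Adj a b := (a.1 = b.1 ∧ (a.2 + 1 = b.2 ∨ b.2 + 1 = a.2)) ∨ (a.2 = b.2 ∧ Γ.Adj a.1 b.1)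
  symm := ⟨fun _ _ h => h.imp (fun h => ⟨h.1.symm, h.2.symm⟩) (fun h => ⟨h.1.symm, h.2.symm⟩)⟩
  loopless := ⟨fun a h => by
    rcases h with ⟨_, h | h⟩ | ⟨_, h⟩
    · omega
    · omega
    · exact Γ.loopless.irrefl _ h⟩

end MetricGraph

/-! ## Word metrics and the Bowditch space -/

section Groups

variable {G : Type*} [Group G]

/-- The group `G` with the word metric of the set `S`, i.e. with the path metric of the Cayley
graph of `G` with respect to `S`, restricted to vertices. -/
def WordMetric (_S : Set G) : Type _ := G

instance (S : Set G) : PseudoEMetricSpace (WordMetric S) where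
  edist g h := ((SimpleGraph.mulCayley S).edist (show G from g) (show G from h) : ℝ≥0∞)
  edist_self g := by
    rw [SimpleGraph.edist_self]
    exact ENat.toENNReal_zero
  edist_comm g h := by rw [SimpleGraph.edist_comm]
  edist_triangle a b c := by
    rw [← ENat.toENNReal_add]
    exact ENat.toENNReal_mono SimpleGraph.edist_triangle

/-- `S` is a finite generating set of `G`, and `S ∩ H i` generates `H i` for every `i`. -/
structure IsCompatibleGenSet {n : ℕ} (H : Fin n → Subgroup G) (S : Set G) : Prop where
  finite : S.Finite
  closure_eq : Subgroup.closure S = ⊤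
  closure_inter : ∀ i, Subgroup.closure (S ∩ (H i : Set G)) = H i

/-- Vertices of the Bowditch space of `(G, (H i)_{i < n})`: the vertices of the Cayley graph of `G`
and, for every `i`, `g` and `k`, the vertex at depth `k + 1` above `g` in the horoball that is glued
to the coset `g H i`. The vertices at depth `0` of the horoballs are the vertices of the coset. -/
inductive Vertex (G : Type*) (n : ℕ) : Type _
  | base (g : G) : Vertex G n
  | horo (i : Fin n) (g : G) (k : ℕ) : Vertex G n

/-- The depth of a vertex, `0` on the Cayley graph. -/
def Vertex.depth {n : ℕ} : Vertex G n → ℕ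
  | .base _ => 0
  | .horo _ _ k => k + 1

/-- Edges of the Bowditch space. The Cayley graph of `G` with respect to `S ∩ H i` is the disjoint
union, over the cosets `g H i`, of copies of the Cayley graph of `H i` with respect to `S ∩ H i`.
So its horoball graph is the disjoint union of the horoballs to be glued to these cosets, and
gluing identifies the vertex `(g, 0)` of it with the vertex `g` of the Cayley graph of `G`. -/
def bowditchAdj {n : ℕ} (H : Fin n → Subgroup G) (S : Set G) : Vertex G n → Vertex G n → Prop
  | .base g, .base g' => (SimpleGraph.mulCayley S).Adj g g'
  | .base g, .horo i g' k =>
      (horoballGraph (SimpleGraph.mulCayley (S ∩ (H i : Set G)))).Adj (g, 0) (g', k + 1)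
  | .horo i g k, .base g' =>
      (horoballGraph (SimpleGraph.mulCayley (S ∩ (H i : Set G)))).Adj (g, k + 1) (g', 0)
  | .horo i g k, .horo j g' k' => i = j ∧
      (horoballGraph (SimpleGraph.mulCayley (S ∩ (H i : Set G)))).Adj (g, k + 1) (g', k' + 1)

/-- The graph underlying the Bowditch space. -/
def bowditchGraph {n : ℕ} (H : Fin n → Subgroup G) (S : Set G) : SimpleGraph (Vertex G n) where
  Adj := bowditchAdj H S
  symm := ⟨by
    rintro (g | ⟨i, g, k⟩) (g' | ⟨j, g', k'⟩) h
    · exact h.symm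
    · exact h.symm
    · exact h.symm
    · obtain ⟨rfl, h⟩ := h
      exact ⟨rfl, h.symm⟩⟩
  loopless := ⟨by
    rintro (g | ⟨i, g, k⟩) h
    · exact (SimpleGraph.mulCayley S).loopless.irrefl _ h
    · exact SimpleGraph.irrefl _ h.2⟩

/-- Lengths of the edges of the Bowditch space: `e^(-k)` for a horizontal edge at depth `k` (hence
`1` for an edge of the Cayley graph), and `1` for a vertical edge. -/
def bowditchLength {n : ℕ} (a b : Vertex G n) : ℝ :=
  if a.depth = b.depth then Real.exp (-(a.depth : ℝ)) else 1

/-- The Bowditch space `X(G) = X(G, {H i}, S)`. -/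
abbrev Bowditch {n : ℕ} (H : Fin n → Subgroup G) (S : Set G) : Type _ :=
  MetricGraph (bowditchGraph H S) bowditchLength

/-- `G` is hyperbolic relative to the subgroups `H i`: the Bowditch space built from some
compatible finite generating set is Gromov hyperbolic. -/
def IsRelHyperbolic {n : ℕ} (H : Fin n → Subgroup G) : Prop :=
  ∃ S : Set G, IsCompatibleGenSet H S ∧ IsGromovHyperbolic (Bowditch H S)

end Groups

end

end BowditchSpace

namespace BowditchSpace

noncomputable section

/-! ## Separated unions of bounded sets -/

section SeparatedUnion

/-! Lower bound. A function on the vertices that changes along each edge by at most the edge length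
bounds distances from below. For the potential log(d(x, y) + e^k), at depth k above y, this shows
that points at distance R have word distance at most exponential in R plus the depth. On the Cayley
graph it makes the inclusion of G a coarse embedding, so covers pull back (`asdim_wordMetric_le`).
At depth about log r, a horoball shows H_i rescaled by about 1/r, so a single cover of X(G) at a
fixed scale pulls back to covers of H_i at every large scale r with members of size proportional to
r (`lasdim_wordMetric_subgroup_le`).

Upper bound. Let N be the right-hand side, assumed finite. A cover of multiplicity n + 1 at a large
scale can be traded for any prescribed number of colours, each a separated union of bounded sets,
such that every point misses at most n colours (`exists_isSepUnion_of_cover`). Use N + 1 colours. At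
bounded depth X(G) looks like G, and every point keeps a colour (`exists_isSepUnion_depth_lt`). In a
slab deep in the horoballs the bound m + 1 ≤ N leaves at least two colours, and linear control makes
the diameters independent of the depth of the slab (`exists_isSepUnion_slab`).

The second colour pays for the gluing in `exists_isSepUnion_of_slabs`. In every other slab each
colour is deleted on its own band of depths. The bands are disjoint, so no point loses both its
colours, and each colour falls apart into blocks of bounded thickness, whose pieces are merged by
`IsSepUnion.union_absorb`. -/

open Classical in
theorem exists_mem_of_card_filter_lt {X : Type*} {F : ℕ → Set X} {x : X} {K : ℕ}
    (h : ((Finset.range K).filter fun c => x ∉ F c).card < K) : ∃ c < K, x ∈ F c := by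
  by_contra hcon
  push Not at hcon
  rw [Finset.filter_true_of_mem fun c hc => hcon c (Finset.mem_range.1 hc),
    Finset.card_range] at h
  exact lt_irrefl _ h

theorem edist_le_ofReal_add {X : Type*} [PseudoEMetricSpace X] {x y z : X} {a b : ℝ} (ha : 0 ≤ a)
    (hb : 0 ≤ b) (hxy : edist x y ≤ ENNReal.ofReal a) (hyz : edist y z ≤ ENNReal.ofReal b) :
    edist x z ≤ ENNReal.ofReal (a + b) := by
  rw [ENNReal.ofReal_add ha hb]
  exact (edist_triangle x y z).trans (add_le_add hxy hyz)

variable {X Y : Type*} [PseudoEMetricSpace X] [PseudoEMetricSpace Y]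

/-- `F` is a union of pairwise `r`-separated sets of diameter at most `D`, the classes of an
equivalence relation. -/
def IsSepUnion (F : Set X) (r D : ℝ) : Prop :=
  ∃ E : Setoid X, ∀ x ∈ F, ∀ y ∈ F,
    (edist x y ≤ ENNReal.ofReal r → E x y) ∧ (E x y → edist x y ≤ ENNReal.ofReal D)

namespace IsSepUnion

theorem mono {F F' : Set X} {r r' D D' : ℝ} (h : IsSepUnion F r D) (hF : F' ⊆ F) (hr : r' ≤ r)
    (hD : D ≤ D') : IsSepUnion F' r' D' := by
  obtain ⟨E, hE⟩ := h
  exact ⟨E, fun x hx y hy =>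
    ⟨fun h => (hE x (hF hx) y (hF hy)).1 (h.trans (ENNReal.ofReal_le_ofReal hr)),
     fun h => ((hE x (hF hx) y (hF hy)).2 h).trans (ENNReal.ofReal_le_ofReal hD)⟩⟩

theorem empty (r D : ℝ) : IsSepUnion (∅ : Set X) r D := ⟨⊤, by simp⟩

theorem comap {F : Set X} {F' : Set Y} {r D r' D' : ℝ} (h : IsSepUnion F' r' D') (φ : X → Y)
    (hφ : ∀ x ∈ F, φ x ∈ F')
    (hr : ∀ x ∈ F, ∀ y ∈ F, edist x y ≤ ENNReal.ofReal r →
      edist (φ x) (φ y) ≤ ENNReal.ofReal r')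
    (hD : ∀ x ∈ F, ∀ y ∈ F, edist (φ x) (φ y) ≤ ENNReal.ofReal D' →
      edist x y ≤ ENNReal.ofReal D) : IsSepUnion F r D := by
  obtain ⟨E, hE⟩ := h
  refine ⟨E.comap φ, fun x hx y hy => ?_⟩
  have := hE _ (hφ x hx) _ (hφ y hy)
  exact ⟨fun h => this.1 (hr x hx y hy h), fun h => hD x hx y hy (this.2 h)⟩

theorem iUnion {ι : Type*} {F : ι → Set X} {r D : ℝ} (h : ∀ i, IsSepUnion (F i) r D)
    (hsep : ∀ i j, ∀ x ∈ F i, ∀ y ∈ F j, edist x y ≤ ENNReal.ofReal r → i = j) :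
    IsSepUnion (⋃ i, F i) r D := by
  choose E hE using h
  have uniq : ∀ i j x, x ∈ F i → x ∈ F j → i = j := fun i j x hi hj =>
    hsep i j x hi x hj (by simp)
  -- Equality is added for reflexivity outside the union. Transitivity holds because `hsep` at
  -- distance zero makes the `F i` pairwise disjoint.
  refine ⟨⟨fun x y => x = y ∨ ∃ i, x ∈ F i ∧ y ∈ F i ∧ E i x y, ⟨fun x => Or.inl rfl, ?_, ?_⟩⟩, ?_⟩
  · rintro x y (rfl | ⟨i, hx, hy, h⟩)
    · exact Or.inl rfl
    · exact Or.inr ⟨i, hy, hx, (E i).symm h⟩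
  · rintro x y z (rfl | ⟨i, hx, hy, h⟩) (rfl | ⟨j, hy', hz, h'⟩)
    · exact Or.inl rfl
    · exact Or.inr ⟨j, hy', hz, h'⟩
    · exact Or.inr ⟨i, hx, hy, h⟩
    · obtain rfl := uniq i j y hy hy'
      exact Or.inr ⟨i, hx, hz, (E i).trans h h'⟩
  · intro x hx y hy
    obtain ⟨i, hx⟩ := Set.mem_iUnion.1 hx
    obtain ⟨j, hy⟩ := Set.mem_iUnion.1 hy
    constructor
    · intro h
      obtain rfl := hsep i j x hx y hy h
      exact Or.inr ⟨i, hx, hy, (hE i x hx y hy).1 h⟩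
    · rintro (rfl | ⟨k, hx', hy', h⟩)
      · simp
      · exact (hE k x hx' y hy').2 h

theorem union_of_separated {A B : Set X} {r D : ℝ} (hA : IsSepUnion A r D)
    (hB : IsSepUnion B r D) (h : ∀ x ∈ A, ∀ y ∈ B, ¬ edist x y ≤ ENNReal.ofReal r) :
    IsSepUnion (A ∪ B) r D := by
  rw [Set.union_eq_iUnion]
  refine iUnion (by rintro (_ | _) <;> assumption) ?_
  rintro (_ | _) (_ | _) x hx y hy hxy
  · rfl
  · exact absurd (by rwa [edist_comm]) (h y hy x hx)
  · exact absurd hxy (h x hx y hy)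
  · rfl

/-- Classes of `A` are absorbed by the classes of `B`, which are much farther apart. -/
theorem union_absorb {A B : Set X} {r D₀ D₁ : ℝ} (hr : 0 ≤ r) (hD₀ : 0 ≤ D₀) (hD₁ : 0 ≤ D₁)
    (hA : IsSepUnion A r D₀) (hB : IsSepUnion B (D₀ + 2 * r) D₁) :
    IsSepUnion (A ∪ B) r (D₁ + 2 * (D₀ + r)) := by
  obtain ⟨EA, hEA⟩ := hA
  obtain ⟨EB, hEB⟩ := hB
  let step : X → X → Prop := fun x y => x ∈ A ∪ B ∧ y ∈ A ∪ B ∧ edist x y ≤ ENNReal.ofReal r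
  have hsymm : Std.Symm step := ⟨fun x y h => ⟨h.2.1, h.1, by rw [edist_comm]; exact h.2.2⟩⟩
  -- A point is attached to `b` if it is `b` or its class in `A` comes within `r` of `b`.
  let att : X → X → Prop := fun y b => b ∈ B ∧
    (y = b ∨ (y ∈ A ∧ ∃ a ∈ A, EA y a ∧ edist a b ≤ ENNReal.ofReal r))
  have hatt : ∀ y b, att y b → edist y b ≤ ENNReal.ofReal (D₀ + r) := by
    rintro y b ⟨hb, rfl | ⟨hy, a, ha, hya, hab⟩⟩
    · simp
    · exact edist_le_ofReal_add hD₀ hr ((hEA y hy a ha).2 hya) hab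
  -- A chain of `r`-steps either stays in one class of `A`, or its ends are attached to one class of
  -- `B`: an excursion from `B` through a class of `A` and back covers at most r + D₀ + r, the
  -- separation of `B`.
  have inv : ∀ x ∈ A ∪ B, ∀ y, Relation.ReflTransGen step x y →
      (x ∈ A ∧ y ∈ A ∧ EA x y) ∨ ∃ b b', att x b ∧ att y b' ∧ EB b b' := by
    intro x hx y hxy
    induction hxy with
    | refl =>
      rcases hx with hx | hx
      · exact Or.inl ⟨hx, hx, EA.refl x⟩
      · exact Or.inr ⟨x, x, ⟨hx, Or.inl rfl⟩, ⟨hx, Or.inl rfl⟩, EB.refl x⟩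
    | @tail y z _ hyz ih =>
      obtain ⟨-, hz, hyz⟩ := hyz
      rcases ih with ⟨hx, hy, hxy⟩ | ⟨b, b', hxb, ⟨hb', hyb⟩, hbb⟩
      · rcases hz with hz | hz
        · exact Or.inl ⟨hx, hz, EA.trans hxy ((hEA y hy z hz).1 hyz)⟩
        · exact Or.inr ⟨z, z, ⟨hz, Or.inr ⟨hx, y, hy, hxy, hyz⟩⟩, ⟨hz, Or.inl rfl⟩, EB.refl z⟩
      · rcases hz with hz | hz
        · refine Or.inr ⟨b, b', hxb, ⟨hb', Or.inr ⟨hz, ?_⟩⟩, hbb⟩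
          rcases hyb with rfl | ⟨hy, a, ha, hya, hab⟩
          · exact ⟨z, hz, EA.refl z, by rwa [edist_comm]⟩
          · exact ⟨a, ha, EA.trans (EA.symm ((hEA y hy z hz).1 hyz)) hya, hab⟩
        · refine Or.inr ⟨b, z, hxb, ⟨hz, Or.inl rfl⟩, EB.trans hbb ?_⟩
          refine (hEB b' hb' z hz).1 ?_
          rcases hyb with rfl | ⟨hy, a, ha, hya, hab⟩
          · exact hyz.trans (ENNReal.ofReal_le_ofReal (by linarith))
          · rw [edist_comm] at hab
            have := edist_le_ofReal_add hr hD₀ hab ((hEA a ha y hy).2 (EA.symm hya))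
            exact (edist_le_ofReal_add (by linarith) hr this hyz).trans
              (ENNReal.ofReal_le_ofReal (by linarith))
  refine ⟨⟨Relation.ReflTransGen step, ⟨fun x => .refl, fun h => ?_, fun h h' => h.trans h'⟩⟩, ?_⟩
  · exact Std.Symm.symm _ _ h
  · intro x hx y hy
    refine ⟨fun h => .single ⟨hx, hy, h⟩, fun h => ?_⟩
    rcases inv x hx y h with ⟨hx, hy, h⟩ | ⟨b, b', hb, hb', h⟩
    · exact ((hEA x hx y hy).2 h).trans (ENNReal.ofReal_le_ofReal (by linarith))
    · have h1 := edist_le_ofReal_add (by linarith) hD₁ (hatt x b hb) ((hEB b hb.1 b' hb'.1).2 h)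
      have h2 := hatt y b' hb'
      rw [edist_comm] at h2
      exact (edist_le_ofReal_add (by linarith) (by linarith) h1 h2).trans
        (ENNReal.ofReal_le_ofReal (by linarith))

end IsSepUnion

/-! ## Covers of bounded multiplicity and separated families -/

theorem card_strict_steps_add_le (a : ℕ → ℕ) (ha : Monotone a) (K : ℕ) :
    ((Finset.range K).filter fun c => a c < a (c + 1)).card + a 0 ≤ a K := by
  induction K with
  | zero => simp
  | succ K ih =>
    rw [Finset.range_add_one, Finset.filter_insert]
    have := ha (Nat.le_add_right K 1)
    split_ifs with h
    · rw [Finset.card_insert_of_notMem (by simp)]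
      omega
    · omega

open Classical in
/-- A cover of large multiplicity scale yields separated families of which every point misses at
most as many as the dimension. -/
theorem exists_isSepUnion_of_cover {𝒰 : Set (Set X)} {R g D : ℝ} {n K : ℕ} (hg : 0 ≤ g)
    (hD : 0 ≤ D) (hR : 2 * K * g ≤ R) (hcov : ⋃₀ 𝒰 = Set.univ) (hdiam : DiamBounded 𝒰 D)
    (hmult : MultiplicityLE 𝒰 R (n + 1)) :
    ∃ F : ℕ → Set X, (∀ c < K, IsSepUnion (F c) g (D + 2 * K * g)) ∧
      ∀ x, ((Finset.range K).filter fun c => x ∉ F c).card ≤ n := by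
  -- The members met by the ball of radius s·g. Their number grows with s from at least 1 to at most
  -- n + 1, so at most n of the K steps are strict; `F c` will collect the points whose step from c
  -- to c + 1 is not.
  let T : ℕ → X → Set (Set X) := fun s x =>
    {U ∈ 𝒰 | (U ∩ {y | edist x y ≤ ENNReal.ofReal (s * g)}).Nonempty}
  have hT : ∀ x, Monotone fun s => T s x := by
    rintro x s t hst U ⟨hU, y, hyU, hy⟩
    refine ⟨hU, y, hyU, le_trans hy (ENNReal.ofReal_le_ofReal ?_)⟩
    have : (s : ℝ) ≤ t := by exact_mod_cast hst
    gcongr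
  have hne : ∀ s x, (T s x).Nonempty := by
    intro s x
    obtain ⟨U, hU, hx⟩ := Set.mem_sUnion.1 (hcov.symm ▸ Set.mem_univ x)
    exact ⟨U, hU, x, hx, by simp⟩
  have hcard : ∀ x, (T K x).encard ≤ n + 1 := by
    refine fun x => hmult _ (Metric.ediam_le fun y hy z hz => ?_)
    rw [Set.mem_ofPred_eq, edist_comm] at hy
    exact (edist_le_ofReal_add (by positivity) (by positivity) hy hz).trans
      (ENNReal.ofReal_le_ofReal (by linarith))
  have hfin : ∀ x, (T K x).Finite := fun x => by
    refine Set.finite_of_encard_le_coe (k := n + 1) ?_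
    exact_mod_cast hcard x
  -- For g-close points of `F c`, T c x ⊆ T (c + 1) y = T c y and symmetrically, so `T c` is
  -- constant on g-chains. Conversely, points with equal `T c` have balls meeting a common member of
  -- the cover.
  refine ⟨fun c => {x | T c x = T (c + 1) x}, fun c hc => ⟨Setoid.ker (T c), ?_⟩, fun x => ?_⟩
  · have hcK : (c : ℝ) ≤ K := by exact_mod_cast hc.le
    have sub : ∀ x y, edist x y ≤ ENNReal.ofReal g → T c x ⊆ T (c + 1) y := by
      rintro x y hxy U ⟨hU, z, hzU, hz⟩
      rw [edist_comm] at hxy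
      refine ⟨hU, z, hzU, ?_⟩
      refine (edist_le_ofReal_add hg (by positivity) hxy hz).trans
        (ENNReal.ofReal_le_ofReal ?_)
      push_cast
      linarith
    intro x hx y hy
    refine ⟨fun h => ?_, fun h => ?_⟩
    · refine Set.Subset.antisymm ?_ ?_
      · rw [show T c y = T (c + 1) y from hy]
        exact sub x y h
      · rw [show T c x = T (c + 1) x from hx]
        exact sub y x (by rwa [edist_comm])
    · replace h : T c x = T c y := h
      obtain ⟨U, hU⟩ := hne c x
      have hU' := hU
      rw [h] at hU'
      obtain ⟨hU0, u, huU, hu⟩ := hU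
      obtain ⟨-, v, hvU, hv⟩ := hU'
      rw [Set.mem_ofPred_eq, edist_comm] at hv
      have h1 := edist_le_ofReal_add (by positivity) hD hu
        ((Metric.edist_le_ediam_of_mem huU hvU).trans (hdiam U hU0))
      refine (edist_le_ofReal_add (by positivity) (by positivity) h1 hv).trans
        (ENNReal.ofReal_le_ofReal ?_)
      have : (c : ℝ) * g ≤ K * g := by gcongr
      linarith
  -- Truncation at K keeps the sets finite, as monotonicity of `ncard` requires.
  · let a : ℕ → ℕ := fun s => (T (min s K) x).ncard
    have hfin' : ∀ s ≤ K, (T s x).Finite := fun s hs => (hfin x).subset (hT x hs)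
    have ha : Monotone a := fun s t hst =>
      Set.ncard_le_ncard (hT x (min_le_min_right K hst)) (hfin' _ (min_le_right _ _))
    have h1 := card_strict_steps_add_le a ha K
    have h0 : 1 ≤ a 0 := (Set.ncard_pos (hfin' _ (min_le_right _ _))).2 (hne _ x)
    have hK : a K ≤ n + 1 := by
      have := hcard x
      rw [← (hfin x).cast_ncard_eq] at this
      simp only [a, min_self]
      exact_mod_cast this
    have hsub : ((Finset.range K).filter fun c => x ∉ {x | T c x = T (c + 1) x}) ⊆
        (Finset.range K).filter fun c => a c < a (c + 1) := by
      intro c hc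
      rw [Finset.mem_filter, Finset.mem_range] at hc ⊢
      refine ⟨hc.1, ?_⟩
      have e1 : min c K = c := min_eq_left hc.1.le
      have e2 : min (c + 1) K = c + 1 := min_eq_left hc.1
      simp only [a, e1, e2]
      exact Set.ncard_lt_ncard ((hT x (Nat.le_add_right c 1)).ssubset_of_ne hc.2)
        (hfin' _ hc.1)
    exact (Finset.card_le_card hsub).trans (by omega)

/-- A set of diameter at most r meets at most one class of each colour, so the colour is injective
on the members that it meets. -/
theorem exists_cover_of_isSepUnion {F : ℕ → Set X} {r D : ℝ} {K : ℕ}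
    (hF : ∀ c < K, IsSepUnion (F c) r D) (hcov : ∀ x, ∃ c < K, x ∈ F c) :
    ∃ 𝒰 : Set (Set X), ⋃₀ 𝒰 = Set.univ ∧ DiamBounded 𝒰 D ∧ MultiplicityLE 𝒰 r K := by
  have : ∀ c, ∃ E : Setoid X, c < K → ∀ x ∈ F c, ∀ y ∈ F c,
      (edist x y ≤ ENNReal.ofReal r → E x y) ∧ (E x y → edist x y ≤ ENNReal.ofReal D) := by
    intro c
    by_cases hc : c < K
    · obtain ⟨E, hE⟩ := hF c hc
      exact ⟨E, fun _ => hE⟩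
    · exact ⟨⊤, fun h => absurd h hc⟩
  choose E hE using this
  let cls : ℕ → X → Set X := fun c x => {y ∈ F c | E c x y}
  refine ⟨{U | ∃ c < K, ∃ x ∈ F c, U = cls c x}, ?_, ?_, ?_⟩
  · refine Set.eq_univ_of_forall fun x => ?_
    obtain ⟨c, hc, hx⟩ := hcov x
    exact ⟨_, ⟨c, hc, x, hx, rfl⟩, hx, (E c).refl x⟩
  · rintro _ ⟨c, hc, x, hx, rfl⟩
    refine Metric.ediam_le fun y hy z hz => ?_
    exact (hE c hc y hy.1 z hz.1).2 ((E c).trans ((E c).symm hy.2) hz.2)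
  · intro A hA
    have key : ∀ U ∈ {U ∈ {U | ∃ c < K, ∃ x ∈ F c, U = cls c x} | (U ∩ A).Nonempty},
        ∃ c < K, ∃ y ∈ A, y ∈ F c ∧ U = cls c y := by
      rintro U ⟨⟨c, hc, x, hx, rfl⟩, y, hy, hyA⟩
      refine ⟨c, hc, y, hyA, hy.1, Set.ext fun z => and_congr_right fun hz => ?_⟩
      exact ⟨fun h => (E c).trans ((E c).symm hy.2) h, fun h => (E c).trans hy.2 h⟩
    choose! col hcol pt using key
    have hKK : ((Finset.range K : Finset ℕ) : Set ℕ).encard = K := by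
      rw [Set.encard_coe_eq_coe_finsetCard, Finset.card_range]
    rw [← hKK]
    refine Set.encard_le_encard_of_injOn (f := col) (fun U hU => by simpa using hcol U hU) ?_
    intro U hU U' hU' h
    obtain ⟨y, hyA, hyF, hy⟩ := pt U hU
    obtain ⟨y', hyA', hyF', hy'⟩ := pt U' hU'
    rw [hy, hy', ← h]
    rw [← h] at hyF'
    have h2 := (hE _ (hcol U hU) _ hyF _ hyF').1
      ((Metric.edist_le_ediam_of_mem hyA hyA').trans hA)
    exact Set.ext fun z => and_congr_right fun hz =>
      ⟨fun h => (E _).trans ((E _).symm h2) h, fun h => (E _).trans h2 h⟩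

end SeparatedUnion

/-! ## Assembling separated families over the slabs of a depth function -/

section Slabs

variable {X : Type*} [PseudoEMetricSpace X]

/-- A Hurewicz-type theorem for a `1`-Lipschitz depth function: separated families on the slabs far
out, which cover doubly, and on the sets of bounded depth combine to separated families. -/
theorem exists_isSepUnion_of_slabs (f : X → ℕ)
    (hf : ∀ x y (r : ℕ), edist x y ≤ ENNReal.ofReal r → f x ≤ f y + r) (K : ℕ)
    (hslab : ∀ (P : ℕ) (r : ℝ), 0 ≤ r → ∃ D, 0 ≤ D ∧ ∃ B₀ : ℕ, ∀ a ≥ B₀, ∃ F : ℕ → Set X,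
      (∀ c < K, IsSepUnion (F c ∩ {x | a ≤ f x ∧ f x < a + P}) r D) ∧
      ∀ x, a ≤ f x → f x < a + P → ∀ c₀, ∃ c < K, c ≠ c₀ ∧ x ∈ F c)
    (hbase : ∀ (B : ℕ) (r : ℝ), 0 ≤ r → ∃ D, 0 ≤ D ∧ ∃ F : ℕ → Set X,
      (∀ c < K, IsSepUnion (F c ∩ {x | f x < B}) r D) ∧ ∀ x, f x < B → ∃ c < K, x ∈ F c)
    (r : ℕ) :
    ∃ D, ∃ F : ℕ → Set X, (∀ c < K, IsSepUnion (F c) r D) ∧ ∀ x, ∃ c < K, x ∈ F c := by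
  -- Bands of width exceeding r cannot be jumped by an r-step, the depth being 1-Lipschitz; a slab
  -- of thickness P = K·w has room for one band per colour.
  set w := r + 1 with hw
  obtain ⟨P, hP⟩ : ∃ P, P = K * w := ⟨_, rfl⟩
  have hcP : ∀ c < K, (c + 1) * w ≤ P := fun c hc => hP ▸ Nat.mul_le_mul_right w hc
  -- The diameter D₀ of the first kind of slab is fixed before the separation D₀ + 2r of the second
  -- kind, as absorption demands.
  obtain ⟨D₀, hD₀, B₀, hA⟩ := hslab P r (by positivity)
  obtain ⟨D₁, hD₁, B₁, hU⟩ := hslab P (D₀ + 2 * r) (by positivity)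
  obtain ⟨B, hB⟩ : ∃ B, B = max B₀ B₁ := ⟨_, rfl⟩
  obtain ⟨D₂, hD₂, FB, hFB, hFBc⟩ := hbase B (D₀ + 2 * r) (by positivity)
  -- Beyond depth B the slabs alternate with period 2P: families `FA` on [s q, s q + P) and `FU` on
  -- [s q + P, s (q + 1)).
  let s : ℕ → ℕ := fun q => B + q * (2 * P)
  have hs0 : s 0 = B := by simp [s]
  have hs1 : ∀ q, s (q + 1) = s q + 2 * P := fun q => by simp only [s]; ring
  have hsB : ∀ q, B ≤ s q := fun q => Nat.le_add_right _ _
  have hsmono : ∀ i j, i < j → s i + 2 * P ≤ s j := fun i j hij => by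
    rw [← hs1]
    exact Nat.add_le_add_left (Nat.mul_le_mul_right _ hij) _
  have hA' := fun q => hA (s q) (le_trans (hB ▸ le_max_left _ _) (hsB q))
  have hU' := fun q => hU (s q + P)
    (le_trans (hB ▸ le_max_right _ _) ((hsB q).trans (Nat.le_add_right _ _)))
  choose FA hFA hFAc using hA'
  choose FU hFU hFUc using hU'
  -- In the `FA` slab of index q, colour c is deleted on its band [s q + c·w, s q + (c + 1)·w).
  -- Block j + 1 is what remains above the band in slab j, the following `FU` slab, and what remains
  -- below the band in slab j + 1. Block 0 starts from the region of depth below B.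
  let Hi : ℕ → ℕ → Set X := fun c j =>
    {x | ∃ q, j = q + 1 ∧ s q + (c + 1) * w ≤ f x ∧ f x < s q + P ∧ x ∈ FA q c}
  let Lo : ℕ → ℕ → Set X := fun c j => {x | s j ≤ f x ∧ f x < s j + c * w ∧ x ∈ FA j c}
  let Un : ℕ → ℕ → Set X := fun c j => {x | (j = 0 ∧ f x < B ∧ x ∈ FB c) ∨
    ∃ q, j = q + 1 ∧ s q + P ≤ f x ∧ f x < s (q + 1) ∧ x ∈ FU q c}
  have sepHi : ∀ c < K, ∀ j, IsSepUnion (Hi c j) r D₀ := by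
    rintro c hc (_ | q)
    · refine (IsSepUnion.empty _ _).mono ?_ le_rfl le_rfl
      rintro x ⟨q, h, -⟩
      omega
    · refine (hFA q c hc).mono ?_ le_rfl le_rfl
      rintro x ⟨q', h, h1, h2, h3⟩
      obtain rfl : q = q' := by omega
      exact ⟨h3, by omega, h2⟩
  have sepLo : ∀ c < K, ∀ j, IsSepUnion (Lo c j) r D₀ := by
    intro c hc j
    refine (hFA j c hc).mono ?_ le_rfl le_rfl
    rintro x ⟨h1, h2, h3⟩
    have := hcP c hc
    rw [add_mul] at this
    exact ⟨h3, h1, by omega⟩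
  have sepUn : ∀ c < K, ∀ j, IsSepUnion (Un c j) (D₀ + 2 * r) (max D₁ D₂) := by
    rintro c hc (_ | q)
    · refine (hFB c hc).mono ?_ le_rfl (le_max_right _ _)
      rintro x (⟨-, h⟩ | ⟨q, h, -⟩)
      · exact ⟨h.2, h.1⟩
      · omega
    · refine (hFU q c hc).mono ?_ le_rfl (le_max_left _ _)
      rintro x (⟨h, -⟩ | ⟨q', h, h1, h2, h3⟩)
      · omega
      · obtain rfl : q = q' := by omega
        rw [hs1] at h2
        exact ⟨h3, h1, by omega⟩
  have sepHiLo : ∀ c < K, ∀ j, ∀ x ∈ Hi c j, ∀ y ∈ Lo c j, ¬ edist x y ≤ ENNReal.ofReal r := by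
    rintro c hc _ x ⟨q, rfl, h1, h2, -⟩ y ⟨h3, -, -⟩ h
    have h4 := hf y x r (by rwa [edist_comm])
    have h5 := hcP c hc
    have h6 : w ≤ (c + 1) * w := Nat.le_mul_of_pos_left _ (Nat.succ_pos c)
    rw [hs1] at h3
    omega
  let home : ℕ → ℕ → Set X := fun c j => (Hi c j ∪ Lo c j) ∪ Un c j
  have sepHome : ∀ c < K, ∀ j, IsSepUnion (home c j) r (max D₁ D₂ + 2 * (D₀ + r)) :=
    fun c hc j => IsSepUnion.union_absorb (by positivity) hD₀ (le_max_of_le_left hD₁)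
      ((sepHi c hc j).union_of_separated (sepLo c hc j) (sepHiLo c hc j)) (sepUn c hc j)
  have home_lt : ∀ c < K, ∀ j, ∀ x ∈ home c j, f x < s j + c * w ∨ f x < s j := by
    rintro c hc j x ((⟨q, rfl, h1, h2, -⟩ | ⟨h1, h2, -⟩) | (⟨rfl, h, -⟩ | ⟨q, rfl, h1, h2, -⟩))
    · rw [hs1]; omega
    · exact Or.inl h2
    · rw [hs0]; exact Or.inr h
    · exact Or.inr h2
  have le_home : ∀ c < K, ∀ q, ∀ x ∈ home c (q + 1), s q + (c + 1) * w ≤ f x := by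
    intro c hc q x hx
    have h5 := hcP c hc
    rcases hx with ((⟨q', h, h1, h2, -⟩ | ⟨h1, h2, -⟩) | (⟨h, -, -⟩ | ⟨q', h, h1, h2, -⟩))
    · obtain rfl : q = q' := by omega
      exact h1
    · rw [hs1] at h1; omega
    · omega
    · obtain rfl : q = q' := by omega
      omega
  have sep_lt : ∀ c < K, ∀ i j, i < j → ∀ x ∈ home c i, ∀ y ∈ home c j,
      ¬ edist x y ≤ ENNReal.ofReal r := by
    intro c hc i j hij x hx y hy h
    obtain ⟨q, rfl⟩ : ∃ q, j = q + 1 := ⟨j - 1, by omega⟩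
    have h1 := home_lt c hc i x hx
    have h2 := le_home c hc q y hy
    have h3 := hf y x r (by rwa [edist_comm])
    have h4 : s i ≤ s q := by
      rcases Nat.lt_or_ge i q with h | h
      · exact (Nat.le_add_right _ _).trans (hsmono i q h)
      · rw [show i = q by omega]
    rw [add_mul] at h2
    omega
  refine ⟨max D₁ D₂ + 2 * (D₀ + r), fun c => ⋃ j, home c j, fun c hc => ?_, fun x => ?_⟩
  · refine IsSepUnion.iUnion (sepHome c hc) fun i j x hx y hy h => ?_
    rcases lt_trichotomy i j with hij | hij | hij
    · exact absurd h (sep_lt c hc i j hij x hx y hy)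
    · exact hij
    · exact absurd (by rwa [edist_comm]) (sep_lt c hc j i hij y hy x hx)
  · rcases Nat.lt_or_ge (f x) B with hx | hx
    · obtain ⟨c, hc, h⟩ := hFBc x hx
      exact ⟨c, hc, Set.mem_iUnion.2 ⟨0, Or.inr (Or.inl ⟨rfl, hx, h⟩)⟩⟩
    · have hKpos : 0 < K := by
        by_contra hK
        obtain rfl : K = 0 := by omega
        have hP0 : P = 0 := by simp [hP]
        obtain ⟨D, -, F, -, hF⟩ := hbase (f x + 1) 0 le_rfl
        obtain ⟨c, hc, -⟩ := hF x (by omega)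
        omega
      have hPpos : 0 < 2 * P := by
        have : 0 < K * w := Nat.mul_pos hKpos (by omega)
        omega
      obtain ⟨q, hq⟩ : ∃ q, q = (f x - B) / (2 * P) := ⟨_, rfl⟩
      have hmod := Nat.div_add_mod (f x - B) (2 * P)
      have hlt := Nat.mod_lt (f x - B) hPpos
      rw [← hq, mul_comm] at hmod
      have hs : s q = B + q * (2 * P) := rfl
      have h1 : s q ≤ f x := by omega
      have h2 : f x < s q + 2 * P := by omega
      rcases Nat.lt_or_ge (f x) (s q + P) with h3 | h3
      -- The quotient is the index of the band containing x. A colour different from it survives at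
      -- x, which lies above the band of a smaller colour and below that of a larger one.
      · obtain ⟨c, hc, hne, hxc⟩ := hFAc q x h1 h3 ((f x - s q) / w)
        refine ⟨c, hc, ?_⟩
        have hwpos : 0 < w := by omega
        rcases Nat.lt_or_gt_of_ne hne with h | h
        · have h4 := (Nat.le_div_iff_mul_le hwpos).1 (Nat.succ_le_of_lt h)
          refine Set.mem_iUnion.2 ⟨q + 1, Or.inl (Or.inl ⟨q, rfl, ?_, h3, hxc⟩)⟩
          simp only [Nat.succ_eq_add_one] at h4
          omega
        · have h4 := (Nat.div_lt_iff_lt_mul hwpos).1 h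
          exact Set.mem_iUnion.2 ⟨q, Or.inl (Or.inr ⟨h1, by omega, hxc⟩)⟩
      · obtain ⟨c, hc, -, hxc⟩ := hFUc q x h3 (by omega) 0
        exact ⟨c, hc, Set.mem_iUnion.2
          ⟨q + 1, Or.inr (Or.inr ⟨q, rfl, h3, by rw [hs1]; omega, hxc⟩)⟩⟩

end Slabs

/-! ## Distances between vertices of a metric graph -/

section MetricGraph

variable {V : Type*} {Γ : SimpleGraph V} {ℓ : V → V → ℝ}

/-- A vertex as a point of the metric graph. -/
def vertexPoint (Γ : SimpleGraph V) (ℓ : V → V → ℝ) (v : V) : MetricGraph Γ ℓ :=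
  ⟨Finsupp.single v 1, Or.inl ⟨v, rfl⟩⟩

/-- The vertices of a metric graph, with the induced metric. -/
def VertexSpace (_Γ : SimpleGraph V) (_ℓ : V → V → ℝ) : Type _ := V

instance (Γ : SimpleGraph V) (ℓ : V → V → ℝ) : PseudoEMetricSpace (VertexSpace Γ ℓ) :=
  PseudoEMetricSpace.induced (vertexPoint Γ ℓ) inferInstance

theorem edgePoint_zero (u v : V) : edgePoint u v 0 = Finsupp.single u 1 := by
  simp [edgePoint]

theorem edgePoint_one (u v : V) : edgePoint u v 1 = Finsupp.single v 1 := by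
  simp [edgePoint]

/-- In barycentric coordinates the linear extension of `φ` is affine on each edge, so a segment of
an edge changes it by at most its length. -/
theorem PLPath.abs_linearCombination_sub_le {φ : V → ℝ}
    (hφ : ∀ u v, Γ.Adj u v → |φ u - φ v| ≤ ℓ u v) {p q : V →₀ ℝ} {L : ℝ}
    (h : PLPath Γ ℓ p q L) :
    |Finsupp.linearCombination ℝ φ p - Finsupp.linearCombination ℝ φ q| ≤ L := by
  induction h with
  | nil p => simp
  | @cons u v huv s t hs ht q L _ ih =>
    refine (abs_sub_le _ (Finsupp.linearCombination ℝ φ (edgePoint u v t)) _).trans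
      (add_le_add ?_ ih)
    have : Finsupp.linearCombination ℝ φ (edgePoint u v s) -
        Finsupp.linearCombination ℝ φ (edgePoint u v t) = (φ u - φ v) * (t - s) := by
      simp only [edgePoint, map_add, Finsupp.linearCombination_single, smul_eq_mul]
      ring
    rw [this, abs_mul, abs_sub_comm t s]
    gcongr
    exact hφ u v huv

/-- A function on the vertices that is `1`-Lipschitz on edges bounds the distance from below. -/
theorem abs_sub_le_of_edist_le {φ : V → ℝ} (hφ : ∀ u v, Γ.Adj u v → |φ u - φ v| ≤ ℓ u v)
    {a b : V} {R : ℝ} (hR : 0 ≤ R)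
    (h : edist (vertexPoint Γ ℓ a) (vertexPoint Γ ℓ b) ≤ ENNReal.ofReal R) :
    |φ a - φ b| ≤ R := by
  rw [← ENNReal.ofReal_le_ofReal_iff hR]
  refine le_trans (le_iInf₂ fun L hL => ENNReal.ofReal_le_ofReal ?_) h
  simpa [vertexPoint] using hL.abs_linearCombination_sub_le hφ

theorem edist_vertexPoint_le_of_adj {u v : V} (h : Γ.Adj u v) :
    edist (vertexPoint Γ ℓ u) (vertexPoint Γ ℓ v) ≤ ENNReal.ofReal (ℓ u v) := by
  have := PLPath.cons (ℓ := ℓ) h (s := 0) (t := 1) (by simp) (by simp) (PLPath.nil _)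
  rw [edgePoint_zero, edgePoint_one] at this
  exact (iInf₂_le _ this).trans (by simp)

theorem exists_vertexPoint_edist_le {C : ℝ} (hℓ : ∀ u v, 0 ≤ ℓ u v ∧ ℓ u v ≤ C)
    (p : MetricGraph Γ ℓ) : ∃ v, edist p (vertexPoint Γ ℓ v) ≤ ENNReal.ofReal C := by
  obtain ⟨p, ⟨v, rfl⟩ | ⟨u, v, huv, t, ht, rfl⟩⟩ := p
  · refine ⟨v, le_trans (le_of_eq ?_) zero_le⟩
    exact edist_self (vertexPoint Γ ℓ v)
  · refine ⟨u, ?_⟩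
    have := PLPath.cons (ℓ := ℓ) huv (s := t) (t := 0) ht (by simp) (PLPath.nil _)
    rw [edgePoint_zero] at this
    refine (iInf₂_le _ this).trans (ENNReal.ofReal_le_ofReal ?_)
    rw [sub_zero, add_zero, abs_of_nonneg ht.1]
    exact (mul_le_of_le_one_right (hℓ u v).1 ht.2).trans (hℓ u v).2

end MetricGraph

/-! ## Word metrics -/

section WordMetric

variable {G : Type*} [Group G]

theorem mulCayley_connected {S : Set G} (hS : Subgroup.closure S = ⊤) :
    (SimpleGraph.mulCayley S).Connected := by
  have key : ∀ g ∈ Subgroup.closure S, ∀ x : G,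
      (SimpleGraph.mulCayley S).Reachable x (x * g) := by
    intro g hg
    induction hg using Subgroup.closure_induction with
    | mem s hs =>
      intro x
      by_cases h : x = x * s
      · rw [← h]
      · refine SimpleGraph.Adj.reachable ?_
        rw [SimpleGraph.mulCayley_adj]
        exact ⟨h, Or.inl (by simpa using hs)⟩
    | one => intro x; rw [mul_one]
    | mul a b _ _ ha hb => intro x; rw [← mul_assoc]; exact (ha x).trans (hb _)
    | inv a _ ha => intro x; simpa using (ha (x * a⁻¹)).symm
  refine (SimpleGraph.connected_iff _).2 ⟨fun x y => ?_, ⟨1⟩⟩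
  simpa using key (x⁻¹ * y) (hS ▸ Subgroup.mem_top _) x

theorem closure_preimage_eq_top {S : Set G} {H : Subgroup G}
    (h : Subgroup.closure (S ∩ (H : Set G)) = H) :
    Subgroup.closure ((Subtype.val : H → G) ⁻¹' S) = ⊤ := by
  apply Subgroup.map_injective H.subtype_injective
  rw [MonoidHom.map_closure, ← MonoidHom.range_eq_map, Subgroup.range_subtype]
  conv_rhs => rw [← h]
  congr 1
  rw [Set.inter_comm]
  exact Subtype.image_preimage_coe _ _

/-- The natural number valued word metric. -/
def wordDist (S : Set G) (g h : G) : ℕ := (SimpleGraph.mulCayley S).dist g h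

theorem edist_wordMetric_le_iff {S : Set G} (hS : Subgroup.closure S = ⊤) (x y : WordMetric S)
    {t : ℝ} (ht : 0 ≤ t) :
    edist x y ≤ ENNReal.ofReal t ↔ (wordDist (G := G) S x y : ℝ) ≤ t := by
  have h : edist x y = ENNReal.ofReal (wordDist (G := G) S x y) := by
    have hd := ((mulCayley_connected hS).preconnected x y).coe_dist_eq_edist
    refine (congrArg (fun z : ℕ∞ => (z : ℝ≥0∞)) hd.symm).trans ?_
    simp [wordDist]
  rw [h, ENNReal.ofReal_le_ofReal_iff ht]

theorem abs_wordDist_sub_le {S : Set G} {g h : G} (hS : Subgroup.closure S = ⊤)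
    (hadj : (SimpleGraph.mulCayley S).Adj g h) (x : G) :
    |(wordDist S x g : ℝ) - wordDist S x h| ≤ 1 := by
  have hc := mulCayley_connected hS
  have h1 := SimpleGraph.dist_eq_one_iff_adj.2 hadj
  have h2 := SimpleGraph.dist_eq_one_iff_adj.2 hadj.symm
  have h3 := hc.dist_triangle (u := x) (v := g) (w := h)
  have h4 := hc.dist_triangle (u := x) (v := h) (w := g)
  rw [h1] at h3
  rw [h2] at h4
  rw [abs_le]
  have h3' : (wordDist S x h : ℝ) ≤ wordDist S x g + 1 := by exact_mod_cast h3
  have h4' : (wordDist S x g : ℝ) ≤ wordDist S x h + 1 := by exact_mod_cast h4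
  constructor <;> linarith

theorem edist_le_of_adj {S : Set G} {X : Type*} [PseudoEMetricSpace X] (f : G → X) {c : ℝ}
    (hc : 0 ≤ c) (hS : Subgroup.closure S = ⊤)
    (hf : ∀ g h, (SimpleGraph.mulCayley S).Adj g h → edist (f g) (f h) ≤ ENNReal.ofReal c)
    (g h : G) : edist (f g) (f h) ≤ ENNReal.ofReal (wordDist S g h * c) := by
  obtain ⟨p, hp⟩ := (mulCayley_connected hS).exists_walk_length_eq_dist g h
  rw [wordDist, ← hp]
  clear hp
  induction p with
  | nil => simp
  | cons hadj p ih =>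
    refine (edist_le_ofReal_add hc (by positivity) (hf _ _ hadj) ih).trans
      (ENNReal.ofReal_le_ofReal ?_)
    rw [SimpleGraph.Walk.length_cons]
    push_cast
    linarith

end WordMetric

/-! ## Distances in the Bowditch space -/

/-! ### The logarithmic potential -/

section Logarithm

open Real

/-- The derivative of log(t + e^k) in t ≥ 0 is at most e^(-k), exactly the length of a horizontal
edge at depth k. -/
theorem log_add_exp_horizontal {s t k : ℝ} (hs : 0 ≤ s) (ht : 0 ≤ t) (hst : |s - t| ≤ 1) :
    |log (s + exp k) - log (t + exp k)| ≤ exp (-k) := by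
  have key : ∀ s t : ℝ, 0 ≤ s → 0 ≤ t → s - t ≤ 1 →
      log (s + exp k) - log (t + exp k) ≤ exp (-k) := by
    intro s t hs ht hst
    have hk := exp_pos k
    rw [← log_div (by positivity) (by positivity)]
    refine (log_le_sub_one_of_pos (by positivity)).trans ?_
    rw [div_sub_one (by positivity), div_le_iff₀ (by positivity), mul_add, ← exp_add]
    simp only [neg_add_cancel, exp_zero]
    have : 0 ≤ exp (-k) * t := by positivity
    linarith
  rw [abs_le] at hst ⊢
  have h1 := key s t hs ht hst.2
  have h2 := key t s ht hs (by linarith)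
  constructor <;> linarith

/-- Passing from k to k + 1 multiplies t + e^k by a factor between 1 and e. -/
theorem log_add_exp_vertical {t k : ℝ} (ht : 0 ≤ t) :
    |log (t + exp k) - log (t + exp (k + 1))| ≤ 1 := by
  have hk := exp_pos k
  have hk1 := exp_pos (k + 1)
  have h1 : log (t + exp k) ≤ log (t + exp (k + 1)) :=
    log_le_log (by positivity) (by gcongr; linarith)
  have h2 : log (t + exp (k + 1)) ≤ log ((t + exp k) * exp 1) := by
    refine log_le_log (by positivity) ?_
    rw [add_mul, ← exp_add]
    have : t * 1 ≤ t * exp 1 := by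
      gcongr
      exact one_le_exp (by norm_num)
    linarith
  rw [log_mul (by positivity) (by positivity), log_exp] at h2
  rw [abs_le]
  constructor <;> linarith

theorem le_exp_of_log_add_exp {t k R : ℝ} (ht : 0 ≤ t) (h : log (t + exp k) ≤ R) : t ≤ exp R := by
  have hk := exp_pos k
  have := (log_le_iff_le_exp (by positivity)).1 h
  linarith

end Logarithm

theorem bowditchLength_nonneg_le_one {G : Type*} {n : ℕ} (a b : Vertex G n) :
    0 ≤ bowditchLength a b ∧ bowditchLength a b ≤ 1 := by
  rw [bowditchLength]
  split_ifs
  · exact ⟨(Real.exp_pos _).le, Real.exp_le_one_iff.2 (by simp)⟩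
  · norm_num

/-! ### Comparing distances in the Bowditch space with word distances -/

section Estimates

variable {G : Type*} [Group G] {n : ℕ} {H : Fin n → Subgroup G} {S : Set G}

/-- The element of `G` below a vertex. -/
def Vertex.elt : Vertex G n → G
  | .base g => g
  | .horo _ g _ => g

variable (H S) in
/-- A vertex as a point of the Bowditch space. -/
abbrev bowditchPoint (v : Vertex G n) : Bowditch H S :=
  vertexPoint (bowditchGraph H S) bowditchLength v

theorem bowditchAdj_cases {a b : Vertex G n} (h : (bowditchGraph H S).Adj a b) :
    (a.elt = b.elt ∧ (a.depth + 1 = b.depth ∨ b.depth + 1 = a.depth) ∧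
      bowditchLength a b = 1) ∨
    (a.depth = b.depth ∧ (SimpleGraph.mulCayley S).Adj a.elt b.elt ∧
      bowditchLength a b = Real.exp (-(a.depth : ℝ))) := by
  have hmono : ∀ i, SimpleGraph.mulCayley (S ∩ (H i : Set G)) ≤ SimpleGraph.mulCayley S :=
    fun i => SimpleGraph.mulCayley_mono Set.inter_subset_left
  have vert : ∀ {a b : Vertex G n}, a.elt = b.elt →
      (a.depth + 1 = b.depth ∨ b.depth + 1 = a.depth) →
      (a.elt = b.elt ∧ (a.depth + 1 = b.depth ∨ b.depth + 1 = a.depth) ∧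
      bowditchLength a b = 1) := fun h1 h2 =>
    ⟨h1, h2, if_neg (by omega)⟩
  rcases a with g | ⟨i, g, k⟩ <;> rcases b with g' | ⟨j, g', k'⟩
  · exact Or.inr ⟨rfl, h, if_pos rfl⟩
  · rcases h with ⟨h1, h2⟩ | ⟨h1, h2⟩
    · exact Or.inl (vert h1 h2)
    · exact absurd h1.symm (Nat.succ_ne_zero _)
  · rcases h with ⟨h1, h2⟩ | ⟨h1, h2⟩
    · exact Or.inl (vert h1 h2)
    · exact absurd h1 (Nat.succ_ne_zero _)
  · obtain ⟨rfl, h⟩ := h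
    rcases h with ⟨h1, h2⟩ | ⟨h1, h2⟩
    · exact Or.inl (vert h1 h2)
    · exact Or.inr ⟨h1, hmono _ h2, if_pos h1⟩

theorem abs_depth_sub_le {a b : Vertex G n} {R : ℝ} (hR : 0 ≤ R)
    (h : edist (bowditchPoint H S a) (bowditchPoint H S b) ≤ ENNReal.ofReal R) :
    |(a.depth : ℝ) - b.depth| ≤ R := by
  refine abs_sub_le_of_edist_le (φ := fun v : Vertex G n => (v.depth : ℝ)) ?_ hR h
  intro u v huv
  rcases bowditchAdj_cases huv with ⟨-, h | h, hl⟩ | ⟨h, -, hl⟩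
  · rw [hl, ← h]; push_cast; simp
  · rw [hl, ← h]; push_cast; simp
  · rw [hl, h, sub_self, abs_zero]; positivity

/-- The logarithmic potential based at `a` is 1-Lipschitz on edges and equals the depth of `a` at
`a`, so at `b` it is at most that depth plus R. -/
theorem wordDist_le_exp (hS : Subgroup.closure S = ⊤) {a b : Vertex G n} {R : ℝ} (hR : 0 ≤ R)
    (h : edist (bowditchPoint H S a) (bowditchPoint H S b) ≤ ENNReal.ofReal R) :
    (wordDist S a.elt b.elt : ℝ) ≤ Real.exp (a.depth + R) := by
  have key : |_ - _| ≤ R := abs_sub_le_of_edist_le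
    (φ := fun v : Vertex G n => Real.log (wordDist S a.elt v.elt + Real.exp v.depth)) ?_ hR h
  · simp only [wordDist, SimpleGraph.dist_self, Nat.cast_zero, zero_add, Real.log_exp] at key
    refine le_exp_of_log_add_exp (k := b.depth) (by positivity) ?_
    rw [wordDist]
    linarith [(abs_le.1 key).1]
  · intro u v huv
    rcases bowditchAdj_cases huv with ⟨he, h | h, hl⟩ | ⟨h, hadj, hl⟩
    · rw [hl, he, ← h]
      push_cast
      exact log_add_exp_vertical (by positivity)
    · rw [hl, he, ← h, abs_sub_comm]
      push_cast
      exact log_add_exp_vertical (by positivity)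
    · rw [hl, h]
      exact log_add_exp_horizontal (by positivity) (by positivity)
        (abs_wordDist_sub_le hS hadj _)

open Classical in
/-- The extension by zero of a function on the horoball over the coset `t H i`. -/
def horoballExtend (i : Fin n) (t : G) (F : H i → ℕ → ℝ) : Vertex G n → ℝ
  | .base _ => 0
  | .horo j g k => if h : j = i ∧ t⁻¹ * g ∈ H i then F ⟨t⁻¹ * g, h.2⟩ (k + 1) else 0

theorem horoballExtend_horo (i : Fin n) (t : G) (F : H i → ℕ → ℝ) (h : H i) (k : ℕ) :
    horoballExtend i t F (.horo i (t * h) k) = F h (k + 1) := by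
  have : i = i ∧ t⁻¹ * (t * h) ∈ H i := ⟨rfl, by simp⟩
  rw [horoballExtend, dif_pos this]
  congr 1
  simp

/-- The horoball over a coset is left only through depth 0, where `F` vanishes, and its horizontal
edges stay over the coset. Hence extending by zero creates no jump. -/
theorem abs_horoballExtend_sub_le {i : Fin n} (t : G) {F : H i → ℕ → ℝ} (h0 : ∀ h, F h 0 = 0)
    (hvert : ∀ h k, |F h k - F h (k + 1)| ≤ 1)
    (hhor : ∀ h h' k, (SimpleGraph.mulCayley ((Subtype.val : H i → G) ⁻¹' S)).Adj h h' →
      |F h k - F h' k| ≤ Real.exp (-(k : ℝ)))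
    (u v : Vertex G n) (huv : (bowditchGraph H S).Adj u v) :
    |horoballExtend i t F u - horoballExtend i t F v| ≤ bowditchLength u v := by
  have base_horo : ∀ j g, |horoballExtend i t F (.horo j g 0)| ≤ 1 := by
    intro j g
    rw [horoballExtend]
    split_ifs with h
    · have := hvert ⟨_, h.2⟩ 0
      rwa [h0, zero_sub, abs_neg] at this
    · simp
  have vert : ∀ j g k, |horoballExtend i t F (.horo j g k) -
      horoballExtend i t F (.horo j g (k + 1))| ≤ 1 := by
    intro j g k
    simp only [horoballExtend]
    split_ifs with h
    · exact hvert _ _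
    · simp
  rcases u with g | ⟨j, g, k⟩ <;> rcases v with g' | ⟨j', g', k'⟩
  · simpa [horoballExtend] using (bowditchLength_nonneg_le_one _ _).1
  · rcases huv with ⟨h1, h2⟩ | ⟨h1, -⟩
    · obtain rfl : k' = 0 := by simpa using h2
      have hl : bowditchLength (.base g) (.horo j' g' 0) = 1 := if_neg (by simp [Vertex.depth])
      rw [hl]
      simpa [horoballExtend] using base_horo j' g'
    · simp at h1
  · rcases huv with ⟨h1, h2⟩ | ⟨h1, -⟩
    · obtain rfl : k = 0 := by simpa using h2
      have hl : bowditchLength (.horo j g 0) (.base g') = 1 := if_neg (by simp [Vertex.depth])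
      rw [hl]
      simpa [horoballExtend] using base_horo j g
    · simp at h1
  · obtain ⟨rfl, ⟨h1, h2⟩ | ⟨h1, h2⟩⟩ := huv
    · have hl : bowditchLength (.horo j g k) (.horo j g' k') = 1 :=
        if_neg (by simp only [Vertex.depth]; simp only at h2; omega)
      simp only at h1 h2
      subst h1
      rw [hl]
      rcases h2 with h2 | h2
      · obtain rfl : k' = k + 1 := by omega
        exact vert _ _ _
      · obtain rfl : k = k' + 1 := by omega
        rw [abs_sub_comm]
        exact vert _ _ _
    · obtain rfl : k = k' := by simpa using h1
      simp only at h2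
      have hl : bowditchLength (.horo j g k) (.horo j g' k) = Real.exp (-((k + 1 : ℕ) : ℝ)) :=
        if_pos rfl
      rw [hl]
      by_cases hj : j = i
      · subst hj
        rw [SimpleGraph.mulCayley_adj] at h2
        obtain ⟨hne, hmem⟩ := h2
        have hH : g⁻¹ * g' ∈ H j := by
          rcases hmem with hm | hm
          · exact hm.2
          · have := (H j).inv_mem hm.2
            simpa using this
        have hiff : t⁻¹ * g ∈ H j ↔ t⁻¹ * g' ∈ H j := by
          rw [show t⁻¹ * g' = t⁻¹ * g * (g⁻¹ * g') by group]
          exact ((H j).mul_mem_cancel_right hH).symm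
        by_cases hg : t⁻¹ * g ∈ H j
        · have hg' := hiff.1 hg
          rw [horoballExtend, dif_pos ⟨rfl, hg⟩, horoballExtend, dif_pos ⟨rfl, hg'⟩]
          refine hhor _ _ _ ?_
          rw [SimpleGraph.mulCayley_adj]
          refine ⟨fun h => hne ?_, ?_⟩
          · simpa using congrArg Subtype.val h
          · refine hmem.imp (fun hm => ?_) (fun hm => ?_)
            · simpa [mul_assoc] using hm.1
            · simpa [mul_assoc] using hm.1
        · have hg' := fun h => hg (hiff.2 h)
          rw [horoballExtend, dif_neg (fun h => hg h.2), horoballExtend,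
            dif_neg (fun h => hg' h.2), sub_zero, abs_zero]
          positivity
      · rw [horoballExtend, dif_neg (fun h => hj h.1), horoballExtend,
          dif_neg (fun h => hj h.1), sub_zero, abs_zero]
        positivity

/-- The depth inside this horoball, extended by zero, is 1-Lipschitz and starts above R, so it is
still positive at `w`. -/
theorem exists_eq_horo_of_edist_le {i : Fin n} {g : G} {k : ℕ} {w : Vertex G n} {R : ℝ}
    (hR : 0 ≤ R) (hRk : R < k + 1)
    (h : edist (bowditchPoint H S (.horo i g k)) (bowditchPoint H S w) ≤ ENNReal.ofReal R) :
    ∃ g' k', w = .horo i g' k' ∧ g⁻¹ * g' ∈ H i := by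
  have key := abs_sub_le_of_edist_le (φ := horoballExtend i g fun (_ : H i) k => (k : ℝ))
    (abs_horoballExtend_sub_le g (by simp) (by simp) (fun _ _ _ _ => by simp; positivity)) hR h
  have h1 := horoballExtend_horo i g (fun (_ : H i) k => (k : ℝ)) 1 k
  rw [Subgroup.coe_one, mul_one] at h1
  rw [h1] at key
  push_cast at key
  rcases w with g' | ⟨j, g', k'⟩
  · have := (abs_le.1 key).2
    simp only [horoballExtend] at this
    linarith
  · by_cases hj : j = i ∧ g⁻¹ * g' ∈ H i
    · exact ⟨g', k', by rw [hj.1], hj.2⟩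
    · have := (abs_le.1 key).2
      rw [horoballExtend, dif_neg hj] at this
      linarith

/-- The word metric of H_i may be distorted in G, so the potential must live on a single horoball
and be cut off near its boundary. -/
theorem wordDist_subgroup_le_exp {i : Fin n}
    (hS : Subgroup.closure ((Subtype.val : H i → G) ⁻¹' S) = ⊤) {t : G} {x y : H i} {k k' : ℕ}
    {R : ℝ} (hR : 0 ≤ R) (hRk : R < k' + 1)
    (h : edist (bowditchPoint H S (.horo i (t * x) k)) (bowditchPoint H S (.horo i (t * y) k')) ≤
      ENNReal.ofReal R) :
    (wordDist ((Subtype.val : H i → G) ⁻¹' S) x y : ℝ) ≤ Real.exp (k + 1 + R) := by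
  let T : Set (H i) := (Subtype.val : H i → G) ⁻¹' S
  let A : H i → ℕ → ℝ := fun z l =>
    Real.log (wordDist T x z + Real.exp l) - (k + 1)
  -- The minimum with the depth and the maximum with 0 force the value 0 at depth 0. At `y` the
  -- cutoff by depth is not felt, since R < k' + 1.
  let F : H i → ℕ → ℝ := fun z l => max 0 (min (A z l) l)
  have key := abs_sub_le_of_edist_le (φ := horoballExtend i t F)
    (abs_horoballExtend_sub_le t (fun z => by simp [F]) (fun z l => ?_) (fun z z' l hz => ?_)) hR h
  · rw [horoballExtend_horo, horoballExtend_horo] at key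
    have hx : F x (k + 1) = 0 := by
      simp [F, A, wordDist]
    rw [hx, zero_sub, abs_neg] at key
    have hy := (le_max_right _ _).trans ((le_abs_self _).trans key)
    have hmin : A y (k' + 1) ≤ R := by
      rcases min_le_iff.1 hy with h | h
      · exact h
      · push_cast at h
        linarith
    refine le_exp_of_log_add_exp (k := ((k' + 1 : ℕ) : ℝ)) (by positivity) ?_
    simp only [A] at hmin
    linarith
  · refine (abs_max_sub_max_le_max _ _ _ _).trans ?_
    rw [sub_self, abs_zero]
    refine max_le zero_le_one ((abs_min_sub_min_le_max _ _ _ _).trans (max_le ?_ ?_))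
    · simp only [A, sub_sub_sub_cancel_right]
      push_cast
      exact log_add_exp_vertical (by positivity)
    · push_cast
      simp
  · have hl := Real.exp_pos (-(l : ℝ))
    refine (abs_max_sub_max_le_max _ _ _ _).trans ?_
    rw [sub_self, abs_zero]
    refine max_le hl.le ((abs_min_sub_min_le_max _ _ _ _).trans (max_le ?_ ?_))
    · simp only [A, sub_sub_sub_cancel_right]
      exact log_add_exp_horizontal (by positivity) (by positivity)
        (abs_wordDist_sub_le hS hz _)
    · simpa using hl.le

theorem edist_base_base_le (hS : Subgroup.closure S = ⊤) (g h : G) :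
    edist (bowditchPoint H S (.base g)) (bowditchPoint H S (.base h)) ≤
      ENNReal.ofReal (wordDist S g h) := by
  have := edist_le_of_adj (fun g => bowditchPoint H S (.base g)) zero_le_one hS
    (fun g h hgh => ?_) g h
  · simpa using this
  · have hadj : (bowditchGraph H S).Adj (.base g) (.base h) := hgh
    exact (edist_vertexPoint_le_of_adj hadj).trans
      (ENNReal.ofReal_le_ofReal (bowditchLength_nonneg_le_one _ _).2)

theorem edist_base_elt_le (v : Vertex G n) :
    edist (bowditchPoint H S (.base v.elt)) (bowditchPoint H S v) ≤ ENNReal.ofReal v.depth := by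
  rcases v with g | ⟨i, g, k⟩
  · simp [Vertex.elt]
  · induction k with
    | zero =>
      have hadj : (bowditchGraph H S).Adj (.base g) (.horo i g 0) := Or.inl ⟨rfl, Or.inl rfl⟩
      refine (edist_vertexPoint_le_of_adj hadj).trans
        (ENNReal.ofReal_le_ofReal ((bowditchLength_nonneg_le_one _ _).2.trans ?_))
      simp [Vertex.depth]
    | succ k ih =>
      have hadj : (bowditchGraph H S).Adj (.horo i g k) (.horo i g (k + 1)) :=
        ⟨rfl, Or.inl ⟨rfl, Or.inl rfl⟩⟩
      refine (edist_le_ofReal_add (by positivity) zero_le_one ih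
        ((edist_vertexPoint_le_of_adj hadj).trans
        (ENNReal.ofReal_le_ofReal (bowditchLength_nonneg_le_one _ _).2))).trans
        (ENNReal.ofReal_le_ofReal ?_)
      simp [Vertex.depth]

theorem edist_horo_vertical_le (i : Fin n) (g : G) (k j : ℕ) :
    edist (bowditchPoint H S (.horo i g k)) (bowditchPoint H S (.horo i g (k + j))) ≤
      ENNReal.ofReal j := by
  induction j with
  | zero => simp
  | succ j ih =>
    have hadj : (bowditchGraph H S).Adj (.horo i g (k + j)) (.horo i g (k + (j + 1))) :=
      ⟨rfl, Or.inl ⟨rfl, Or.inl rfl⟩⟩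
    refine (edist_le_ofReal_add (by positivity) zero_le_one ih
      ((edist_vertexPoint_le_of_adj hadj).trans
      (ENNReal.ofReal_le_ofReal (bowditchLength_nonneg_le_one _ _).2))).trans
      (ENNReal.ofReal_le_ofReal ?_)
    simp

theorem edist_horo_horizontal_le {i : Fin n}
    (hS : Subgroup.closure ((Subtype.val : H i → G) ⁻¹' S) = ⊤) (t : G) (x y : H i) (k : ℕ) :
    edist (bowditchPoint H S (.horo i (t * x) k)) (bowditchPoint H S (.horo i (t * y) k)) ≤
      ENNReal.ofReal (wordDist ((Subtype.val : H i → G) ⁻¹' S) x y *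
        Real.exp (-((k + 1 : ℕ) : ℝ))) := by
  refine edist_le_of_adj (fun x : H i => bowditchPoint H S (.horo i (t * x) k))
    (Real.exp_pos _).le hS (fun x y hxy => ?_) x y
  have hadj : (bowditchGraph H S).Adj (.horo i (t * x) k) (.horo i (t * y) k) := by
    refine ⟨rfl, Or.inr ⟨rfl, ?_⟩⟩
    change (SimpleGraph.mulCayley (S ∩ (H i : Set G))).Adj (t * x) (t * y)
    rw [SimpleGraph.mulCayley_adj] at hxy
    rw [SimpleGraph.mulCayley_adj_mul_iff_right, SimpleGraph.mulCayley_adj]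
    refine ⟨fun h => hxy.1 (Subtype.ext h), hxy.2.imp (fun h => ⟨h, ?_⟩) (fun h => ⟨h, ?_⟩)⟩
    · exact (x⁻¹ * y).2
    · exact (y⁻¹ * x).2
  have hl : bowditchLength (.horo i (t * x) k : Vertex G n) (.horo i (t * y) k) =
      Real.exp (-((k + 1 : ℕ) : ℝ)) := if_pos rfl
  rw [← hl]
  exact edist_vertexPoint_le_of_adj hadj

end Estimates

/-! ## Covers realizing the asymptotic dimensions -/

section Dimension

variable {X Y : Type*} [PseudoEMetricSpace X] [PseudoEMetricSpace Y]

theorem DiamBounded.mono {𝒰 : Set (Set X)} {D D' : ℝ} (h : DiamBounded 𝒰 D) (hD : D ≤ D') :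
    DiamBounded 𝒰 D' :=
  fun U hU => (h U hU).trans (ENNReal.ofReal_le_ofReal hD)

theorem MultiplicityLE.mono {𝒰 : Set (Set X)} {r : ℝ} {k k' : ℕ∞} (h : MultiplicityLE 𝒰 r k)
    (hk : k ≤ k') : MultiplicityLE 𝒰 r k' :=
  fun A hA => (h A hA).trans hk

theorem exists_cover_of_asdim_le {n : ℕ} (h : asdim X ≤ n) {r : ℝ} (hr : 0 < r) :
    ∃ D : ℝ, 0 ≤ D ∧ ∃ 𝒰 : Set (Set X),
      ⋃₀ 𝒰 = Set.univ ∧ DiamBounded 𝒰 D ∧ MultiplicityLE 𝒰 r (n + 1) := by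
  -- A finite infimum in ℕ∞ comes from a nonempty set and is therefore attained.
  have hne : {n : ℕ∞ | ∀ r : ℝ, 0 < r → ∃ D : ℝ, ∃ 𝒰 : Set (Set X),
      ⋃₀ 𝒰 = Set.univ ∧ DiamBounded 𝒰 D ∧ MultiplicityLE 𝒰 r (n + 1)}.Nonempty := by
    by_contra hne
    rw [asdim, Set.not_nonempty_iff_eq_empty.1 hne, sInf_empty, top_le_iff] at h
    exact ENat.natCast_ne_top n h
  obtain ⟨D, 𝒰, h1, h2, h3⟩ := csInf_mem hne r hr
  exact ⟨max D 0, le_max_right _ _, 𝒰, h1, h2.mono (le_max_left _ _), h3.mono (by gcongr; exact h)⟩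

theorem exists_cover_of_lasdim_le {n : ℕ} (h : lasdim X ≤ n) :
    ∃ L : ℝ, ∃ r₀ : ℝ, ∀ r : ℝ, r₀ ≤ r → ∃ 𝒰 : Set (Set X),
      ⋃₀ 𝒰 = Set.univ ∧ DiamBounded 𝒰 (L * r) ∧ MultiplicityLE 𝒰 r (n + 1) := by
  have hne : {n : ℕ∞ | ∃ L : ℝ, ∃ r₀ : ℝ, ∀ r : ℝ, r₀ ≤ r → ∃ 𝒰 : Set (Set X),
      ⋃₀ 𝒰 = Set.univ ∧ DiamBounded 𝒰 (L * r) ∧ MultiplicityLE 𝒰 r (n + 1)}.Nonempty := by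
    by_contra hne
    rw [lasdim, Set.not_nonempty_iff_eq_empty.1 hne, sInf_empty, top_le_iff] at h
    exact ENat.natCast_ne_top n h
  obtain ⟨L, r₀, hL⟩ := csInf_mem hne
  refine ⟨L, r₀, fun r hr => ?_⟩
  obtain ⟨𝒰, h1, h2, h3⟩ := hL r hr
  exact ⟨𝒰, h1, h2, h3.mono (by gcongr; exact h)⟩

/-- Images of sets of diameter at most r' have diameter at most r, and coinciding preimages only
lower the multiplicity. -/
theorem exists_cover_preimage {𝒰 : Set (Set Y)} {D D' r r' : ℝ} {k : ℕ∞} (f : X → Y)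
    (hcov : ⋃₀ 𝒰 = Set.univ) (hdiam : DiamBounded 𝒰 D) (hmult : MultiplicityLE 𝒰 r k)
    (hD : ∀ x y, edist (f x) (f y) ≤ ENNReal.ofReal D → edist x y ≤ ENNReal.ofReal D')
    (hr : ∀ x y, edist x y ≤ ENNReal.ofReal r' → edist (f x) (f y) ≤ ENNReal.ofReal r) :
    ∃ 𝒱 : Set (Set X), ⋃₀ 𝒱 = Set.univ ∧ DiamBounded 𝒱 D' ∧ MultiplicityLE 𝒱 r' k := by
  refine ⟨(fun U => f ⁻¹' U) '' 𝒰, Set.eq_univ_of_forall fun x => ?_, ?_, fun A hA => ?_⟩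
  · obtain ⟨U, hU, hx⟩ := Set.mem_sUnion.1 (hcov.symm ▸ Set.mem_univ (f x))
    exact ⟨_, ⟨U, hU, rfl⟩, hx⟩
  · rintro _ ⟨U, hU, rfl⟩
    exact Metric.ediam_le fun x hx y hy =>
      hD x y ((Metric.edist_le_ediam_of_mem (show f x ∈ U from hx) hy).trans (hdiam U hU))
  · have hfA : Metric.ediam (f '' A) ≤ ENNReal.ofReal r := by
      refine Metric.ediam_le ?_
      rintro _ ⟨x, hx, rfl⟩ _ ⟨y, hy, rfl⟩
      exact hr x y ((Metric.edist_le_ediam_of_mem hx hy).trans hA)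
    refine le_trans (Set.encard_le_encard ?_)
      ((Set.encard_image_le (fun U => f ⁻¹' U) _).trans (hmult _ hfA))
    rintro _ ⟨⟨U, hU, rfl⟩, x, hxU, hxA⟩
    exact ⟨U, ⟨hU, f x, hxU, x, hxA, rfl⟩, rfl⟩

end Dimension

section Bounds

variable {G : Type*} [Group G] {n : ℕ} {H : Fin n → Subgroup G} {S : Set G}

/-! ## The lower bound -/

theorem asdim_wordMetric_le (hS : IsCompatibleGenSet H S) :
    asdim (WordMetric S) ≤ asdim (Bowditch H S) := by
  rcases eq_or_ne (asdim (Bowditch H S)) ⊤ with h | h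
  · rw [h]; exact le_top
  obtain ⟨N, hN⟩ := ENat.ne_top_iff_exists.1 h
  rw [← hN]
  refine sInf_le fun r hr => ?_
  obtain ⟨D, hD, 𝒰, h1, h2, h3⟩ := exists_cover_of_asdim_le hN.ge hr
  refine ⟨Real.exp D, exists_cover_preimage
    (fun g : WordMetric S => bowditchPoint H S (.base g)) h1 h2 h3 (fun x y hxy => ?_)
    (fun x y hxy => ?_)⟩
  · rw [edist_wordMetric_le_iff hS.closure_eq _ _ (Real.exp_pos _).le]
    simpa [Vertex.depth, Vertex.elt] using wordDist_le_exp hS.closure_eq hD hxy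
  · rw [edist_wordMetric_le_iff hS.closure_eq _ _ hr.le] at hxy
    exact (edist_base_base_le hS.closure_eq _ _).trans (ENNReal.ofReal_le_ofReal hxy)

theorem lasdim_wordMetric_subgroup_le (hS : IsCompatibleGenSet H S) (i : Fin n) :
    lasdim (WordMetric ((Subtype.val : H i → G) ⁻¹' S)) ≤ asdim (Bowditch H S) := by
  rcases eq_or_ne (asdim (Bowditch H S)) ⊤ with h | h
  · rw [h]; exact le_top
  obtain ⟨N, hN⟩ := ENat.ne_top_iff_exists.1 h
  rw [← hN]
  have hSi := closure_preimage_eq_top (hS.closure_inter i)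
  -- One scale above e suffices: at depth k + 1 = ⌊log r⌋, elements of H_i at distance r are at
  -- distance at most r·e^(-(k + 1)) ≤ e < 3.
  obtain ⟨D, hD, 𝒰, h1, h2, h3⟩ := exists_cover_of_asdim_le hN.ge (r := 3) (by norm_num)
  -- Sets of diameter D at that depth have diameter at most e^(k + 1 + D) ≤ e^D·r in H_i. The
  -- threshold makes the depth exceed D, so that the estimate inside one horoball applies.
  refine sInf_le ⟨Real.exp D, Real.exp (D + 2), fun r hr => ?_⟩
  have hr0 : 0 < r := (Real.exp_pos _).trans_le hr
  have hlog : D + 2 ≤ Real.log r := (Real.le_log_iff_exp_le hr0).2 hr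
  have hfl := Nat.floor_le (a := Real.log r) (by linarith)
  have hfl' := Nat.lt_floor_add_one (Real.log r)
  obtain ⟨k, hk⟩ : ∃ k, ⌊Real.log r⌋₊ = k + 1 := by
    refine ⟨⌊Real.log r⌋₊ - 1, ?_⟩
    have : 1 ≤ ⌊Real.log r⌋₊ := Nat.le_floor (by push_cast; linarith)
    omega
  rw [hk] at hfl hfl'
  have hDr : 0 ≤ Real.exp D * r := by positivity
  refine exists_cover_preimage
    (fun x : WordMetric ((Subtype.val : H i → G) ⁻¹' S) =>
      bowditchPoint H S (.horo i (1 * Subtype.val (p := (· ∈ H i)) x) k)) h1 h2 h3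
    (fun x y hxy => ?_) (fun x y hxy => ?_)
  · rw [edist_wordMetric_le_iff hSi _ _ hDr]
    push_cast at hfl hfl'
    refine (wordDist_subgroup_le_exp hSi hD (by linarith) hxy).trans ?_
    rw [add_comm, Real.exp_add]
    gcongr
    exact (Real.le_log_iff_exp_le hr0).1 hfl
  · rw [edist_wordMetric_le_iff hSi _ _ hr0.le] at hxy
    refine (edist_horo_horizontal_le hSi 1 _ _ k).trans (ENNReal.ofReal_le_ofReal ?_)
    calc _ ≤ r * Real.exp (-((k + 1 : ℕ) : ℝ)) := by gcongr
      _ = Real.exp (Real.log r - (k + 1 : ℕ)) := by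
        rw [sub_eq_add_neg, Real.exp_add, Real.exp_log hr0]
      _ ≤ Real.exp 1 := Real.exp_le_exp.2 (by linarith)
      _ ≤ 3 := by linarith [Real.exp_one_lt_d9]

/-! ## The upper bound -/

open Classical in
/-- The projection of the horoball over the coset `t H i` to `H i`, extended by `1`. -/
def cosetProj (H : Fin n → Subgroup G) (i : Fin n) (t : G) (v : Vertex G n) : H i :=
  if h : t⁻¹ * v.elt ∈ H i then ⟨t⁻¹ * v.elt, h⟩ else 1

theorem cosetProj_horo (i j : Fin n) (t : G) (x : H i) (k : ℕ) :
    cosetProj H i t (.horo j (t * x) k) = x := by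
  have : t⁻¹ * (Vertex.horo j (t * (x : G)) k : Vertex G n).elt ∈ H i := by simp [Vertex.elt]
  rw [cosetProj, dif_pos this]
  ext
  simp [Vertex.elt]

theorem exists_isSepUnion_depth_lt (hS : IsCompatibleGenSet H S) {N : ℕ}
    (hN : asdim (WordMetric S) ≤ N) (B : ℕ) (r : ℝ) (hr : 0 ≤ r) :
    ∃ D, 0 ≤ D ∧ ∃ F : ℕ → Set (VertexSpace (bowditchGraph H S) bowditchLength),
      (∀ c < N + 1, IsSepUnion (F c ∩ {x | Vertex.depth x < B}) r D) ∧
      ∀ x, Vertex.depth x < B → ∃ c < N + 1, x ∈ F c := by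
  -- Vertices of depth below B at distance at most r lie over elements of G at word distance at most
  -- g.
  set g := Real.exp (B + r) with hg
  have hg0 : 0 < g := Real.exp_pos _
  obtain ⟨D, hD, 𝒰, h1, h2, h3⟩ :=
    exists_cover_of_asdim_le hN (r := 2 * (N + 1 : ℕ) * g) (by positivity)
  obtain ⟨F, hF, hFc⟩ := exists_isSepUnion_of_cover hg0.le hD le_rfl h1 h2 h3
  have hD' : 0 ≤ D + 2 * (N + 1 : ℕ) * g := by positivity
  refine ⟨B + (D + 2 * (N + 1 : ℕ) * g) + B, by positivity,
    fun c => {x | Vertex.elt x ∈ F c}, fun c hc => ?_, fun x _ => ?_⟩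
  · refine (hF c hc).comap (fun x => Vertex.elt x) (fun x hx => hx.1)
      (fun x hx y hy hxy => ?_) (fun x hx y hy hxy => ?_)
    · rw [edist_wordMetric_le_iff hS.closure_eq _ _ hg0.le]
      refine (wordDist_le_exp hS.closure_eq hr hxy).trans (Real.exp_le_exp.2 ?_)
      have : (Vertex.depth x : ℝ) ≤ B := by exact_mod_cast le_of_lt hx.2
      linarith
    · rw [edist_wordMetric_le_iff hS.closure_eq _ _ hD'] at hxy
      have hx' : (Vertex.depth x : ℝ) ≤ B := by exact_mod_cast le_of_lt hx.2
      have hy' : (Vertex.depth y : ℝ) ≤ B := by exact_mod_cast le_of_lt hy.2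
      have e1 := (edist_base_elt_le (H := H) (S := S) x).trans (ENNReal.ofReal_le_ofReal hx')
      have e2 := (edist_base_base_le (H := H) hS.closure_eq (Vertex.elt x) (Vertex.elt y)).trans
        (ENNReal.ofReal_le_ofReal hxy)
      have e3 := (edist_base_elt_le (H := H) (S := S) y).trans (ENNReal.ofReal_le_ofReal hy')
      rw [edist_comm] at e1
      exact edist_le_ofReal_add (by positivity) (by positivity)
        (edist_le_ofReal_add (by positivity) hD' e1 e2) e3
  · exact exists_mem_of_card_filter_lt (X := WordMetric S) (x := Vertex.elt x)
      (Nat.lt_succ_of_le (hFc _))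

theorem exists_uniform_cover {m : ℕ}
    (hm : ∀ i, lasdim (WordMetric ((Subtype.val : H i → G) ⁻¹' S)) ≤ m) :
    ∃ L : ℝ, 0 ≤ L ∧ ∃ r₀ : ℝ, ∀ r : ℝ, 0 ≤ r → r₀ ≤ r → ∀ i,
      ∃ 𝒰 : Set (Set (WordMetric ((Subtype.val : H i → G) ⁻¹' S))),
      ⋃₀ 𝒰 = Set.univ ∧ DiamBounded 𝒰 (L * r) ∧ MultiplicityLE 𝒰 r (m + 1) := by
  choose L r₀ h using fun i => exists_cover_of_lasdim_le (hm i)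
  refine ⟨∑ i, |L i|, Finset.sum_nonneg fun _ _ => abs_nonneg _, ∑ i, |r₀ i|,
    fun r hr hr₀ i => ?_⟩
  have hLi : L i ≤ ∑ i, |L i| := (le_abs_self _).trans
    (Finset.single_le_sum (f := fun i => |L i|) (fun _ _ => abs_nonneg _) (Finset.mem_univ i))
  have hri : r₀ i ≤ ∑ i, |r₀ i| := (le_abs_self _).trans
    (Finset.single_le_sum (f := fun i => |r₀ i|) (fun _ _ => abs_nonneg _) (Finset.mem_univ i))
  obtain ⟨𝒰, h1, h2, h3⟩ := h i r (hri.trans hr₀)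
  exact ⟨𝒰, h1, h2.mono (by gcongr), h3⟩

theorem exists_isSepUnion_slab (hS : IsCompatibleGenSet H S) {m N : ℕ} (hmN : m + 1 ≤ N)
    (hm : ∀ i, lasdim (WordMetric ((Subtype.val : H i → G) ⁻¹' S)) ≤ m) (P : ℕ) (r : ℝ)
    (hr : 0 ≤ r) :
    ∃ D, 0 ≤ D ∧ ∃ B₀ : ℕ, ∀ a ≥ B₀,
      ∃ F : ℕ → Set (VertexSpace (bowditchGraph H S) bowditchLength),
      (∀ c < N + 1, IsSepUnion (F c ∩ {x | a ≤ Vertex.depth x ∧ Vertex.depth x < a + P}) r D) ∧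
      ∀ x, a ≤ Vertex.depth x → Vertex.depth x < a + P →
        ∀ c₀, ∃ c < N + 1, c ≠ c₀ ∧ x ∈ F c := by
  classical
  obtain ⟨L, hL, r₀, hcov⟩ := exists_uniform_cover hm
  set M : ℝ := 2 * (N + 1 : ℕ) with hM
  have hM1 : 1 ≤ M := by rw [hM]; push_cast; linarith [Nat.cast_nonneg (α := ℝ) N]
  -- The families on H_i have diameter (L·M + M)·g with g = e^(a + P + r); at depth at least a this
  -- shrinks by e^(-a), so a cancels. The term P is for vertical motion. The bound on a gives r < a,
  -- which keeps r-close vertices of the slab in one horoball, and M·g ≥ r₀, which makes linear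
  -- control available.
  refine ⟨P + (L * M + M) * Real.exp (P + r), by positivity, ⌈r⌉₊ + ⌈r₀⌉₊ + 1, fun a ha => ?_⟩
  have har : r < a := by
    have h1 := Nat.le_ceil r
    have h2 : ((⌈r⌉₊ + ⌈r₀⌉₊ + 1 : ℕ) : ℝ) ≤ a := by exact_mod_cast ha
    push_cast at h2
    linarith [Nat.cast_nonneg (α := ℝ) ⌈r₀⌉₊]
  set g := Real.exp (a + P + r) with hg
  have hg0 : 0 < g := Real.exp_pos _
  have hgr₀ : r₀ ≤ M * g := by
    have h1 := Nat.le_ceil r₀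
    have h2 : ((⌈r⌉₊ + ⌈r₀⌉₊ + 1 : ℕ) : ℝ) ≤ a := by exact_mod_cast ha
    push_cast at h2
    have h3 := Real.add_one_le_exp (a + P + r)
    have h4 : g ≤ M * g := le_mul_of_one_le_left hg0.le hM1
    linarith [Nat.cast_nonneg (α := ℝ) ⌈r⌉₊, Nat.cast_nonneg (α := ℝ) P]
  have hMg : 0 ≤ M * g := by positivity
  have hLMg : 0 ≤ L * (M * g) := by positivity
  have hex : ∀ i, ∃ F : ℕ → Set (WordMetric ((Subtype.val : H i → G) ⁻¹' S)),
      (∀ c < N + 1, IsSepUnion (F c) g (L * (M * g) + M * g)) ∧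
      ∀ x, ((Finset.range (N + 1)).filter fun c => x ∉ F c).card ≤ m := by
    intro i
    obtain ⟨𝒰, h1, h2, h3⟩ := hcov (M * g) hMg hgr₀ i
    exact exists_isSepUnion_of_cover hg0.le hLMg le_rfl h1 h2 h3
  choose F hF hFc using hex
  let piece : ℕ → (Σ i, G ⧸ H i) → Set (VertexSpace (bowditchGraph H S) bowditchLength) :=
    fun c p => {v | ∃ x : H p.1, ∃ k, v = Vertex.horo p.1 (p.2.out * x) k ∧ x ∈ F p.1 c}
  refine ⟨fun c => ⋃ p, piece c p, fun c hc => ?_, fun v hva _ c₀ => ?_⟩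
  · rw [Set.iUnion_inter]
    refine IsSepUnion.iUnion (fun p => ?_) ?_
    · have hSi := closure_preimage_eq_top (hS.closure_inter p.1)
      refine (hF p.1 c hc).comap (fun v => cosetProj H p.1 p.2.out v) ?_ ?_ ?_
      · rintro _ ⟨⟨x, k, rfl, hx⟩, -⟩
        rwa [cosetProj_horo]
      · rintro _ ⟨⟨x, k, rfl, -⟩, hk⟩ _ ⟨⟨y, k', rfl, -⟩, hk'⟩ hxy
        rw [cosetProj_horo, cosetProj_horo]
        refine (edist_wordMetric_le_iff hSi _ _ hg0.le).2 ?_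
        have h1 : ((k : ℝ) + 1) ≤ a + P := by exact_mod_cast le_of_lt hk.2
        have h2 : (a : ℝ) ≤ k' + 1 := by exact_mod_cast hk'.1
        exact (wordDist_subgroup_le_exp hSi hr (by linarith) hxy).trans
          (Real.exp_le_exp.2 (by linarith))
      -- Move horizontally at the smaller depth, which is still at least a, then vertically by at
      -- most P.
      · have key : ∀ (x y : H p.1) (k k' : ℕ), a ≤ k + 1 → k' + 1 < a + P → k ≤ k' →
            (wordDist ((Subtype.val : H p.1 → G) ⁻¹' S) x y : ℝ) ≤ L * (M * g) + M * g →
            edist (bowditchPoint H S (.horo p.1 (p.2.out * x) k))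
              (bowditchPoint H S (.horo p.1 (p.2.out * y) k')) ≤
              ENNReal.ofReal (P + (L * M + M) * Real.exp (P + r)) := by
          intro x y k k' hk hk' hkk hd
          obtain ⟨j, rfl⟩ := Nat.exists_eq_add_of_le hkk
          refine (edist_le_ofReal_add (by positivity) (by positivity)
            (edist_horo_horizontal_le hSi _ x y k) (edist_horo_vertical_le _ _ k j)).trans
            (ENNReal.ofReal_le_ofReal ?_)
          have hj : (j : ℝ) ≤ P := by
            have : j ≤ P := by omega
            exact_mod_cast this
          have hka : (a : ℝ) ≤ (k + 1 : ℕ) := by exact_mod_cast hk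
          have : (wordDist ((Subtype.val : H p.1 → G) ⁻¹' S) x y : ℝ) *
              Real.exp (-((k + 1 : ℕ) : ℝ)) ≤ (L * (M * g) + M * g) * Real.exp (-(a : ℝ)) := by
            gcongr
          have hexp : g * Real.exp (-(a : ℝ)) = Real.exp (P + r) := by
            rw [hg, ← Real.exp_add]
            congr 1
            ring
          rw [show (L * (M * g) + M * g) * Real.exp (-(a : ℝ)) =
            (L * M + M) * (g * Real.exp (-(a : ℝ))) by ring, hexp] at this
          linarith
        rintro _ ⟨⟨x, k, rfl, -⟩, hk⟩ _ ⟨⟨y, k', rfl, -⟩, hk'⟩ hxy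
        rw [cosetProj_horo, cosetProj_horo] at hxy
        replace hxy := (edist_wordMetric_le_iff hSi _ _ (add_nonneg hLMg hMg)).1 hxy
        rcases le_total k k' with h | h
        · exact key x y k k' hk.1 hk'.2 h hxy
        · rw [wordDist, SimpleGraph.dist_comm] at hxy
          exact (edist_comm _ _).trans_le (key y x k' k hk'.1 hk.2 h hxy)
    · rintro ⟨i, q⟩ ⟨j, q'⟩ _ ⟨⟨x, k, rfl, -⟩, hk⟩ _ ⟨⟨y, k', rfl, -⟩, -⟩ hxy
      have h1 : (a : ℝ) ≤ k + 1 := by exact_mod_cast hk.1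
      obtain ⟨g', k'', heq, hmem⟩ := exists_eq_horo_of_edist_le hr (by linarith) hxy
      simp only [Vertex.horo.injEq] at heq
      obtain ⟨rfl, rfl, -⟩ := heq
      have hq : q = q' := by
        rw [← QuotientGroup.out_eq' q, ← QuotientGroup.out_eq' q', QuotientGroup.eq]
        have := (H j).mul_mem ((H j).mul_mem x.2 hmem) ((H j).inv_mem y.2)
        simpa [mul_assoc] using this
      rw [hq]
  · rcases v with g₀ | ⟨i, g₀, k⟩
    · simp only [Vertex.depth] at hva
      omega
    · have hmem : (g₀ : G ⧸ H i).out⁻¹ * g₀ ∈ H i := by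
        rw [← QuotientGroup.eq, QuotientGroup.out_eq']
      let x : H i := ⟨_, hmem⟩
      -- At least N colours differ from c₀ and at most m < N are missed by x.
      obtain ⟨c, hc, hne, hxc⟩ : ∃ c < N + 1, c ≠ c₀ ∧ x ∈ F i c := by
        by_contra hcon
        push Not at hcon
        have hsub : (Finset.range (N + 1)).erase c₀ ⊆
            (Finset.range (N + 1)).filter fun c => x ∉ F i c := by
          intro c hc
          rw [Finset.mem_erase] at hc
          exact Finset.mem_filter.2 ⟨hc.2, hcon c (Finset.mem_range.1 hc.2) hc.1⟩
        have h1 := Finset.card_le_card hsub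
        have h2 := hFc i x
        have h3 := Finset.pred_card_le_card_erase (s := Finset.range (N + 1)) (a := c₀)
        rw [Finset.card_range] at h3
        exact absurd (h1.trans h2) (by omega)
      refine ⟨c, hc, hne, Set.mem_iUnion.2 ⟨⟨i, (g₀ : G ⧸ H i)⟩, x, k, ?_, hxc⟩⟩
      exact congrArg (fun z => Vertex.horo i z k) (by simp [x])

theorem asdim_bowditch_le (hS : IsCompatibleGenSet H S) {m N : ℕ}
    (hN : asdim (WordMetric S) ≤ N) (hmN : m + 1 ≤ N)
    (hm : ∀ i, lasdim (WordMetric ((Subtype.val : H i → G) ⁻¹' S)) ≤ m) :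
    asdim (Bowditch H S) ≤ N := by
  refine sInf_le fun r hr => ?_
  -- Every point is within 1 of a vertex, so replacing two points by vertices costs 2 in the
  -- separation and 2 in the diameter.
  obtain ⟨D, F, hF, hFc⟩ := exists_isSepUnion_of_slabs
    (X := VertexSpace (bowditchGraph H S) bowditchLength) Vertex.depth
    (fun x y r h => by
      have := (abs_le.1 (abs_depth_sub_le (Nat.cast_nonneg r) h)).2
      have h' : (Vertex.depth x : ℝ) ≤ Vertex.depth y + r := by linarith
      exact_mod_cast h') (N + 1)
    (exists_isSepUnion_slab hS hmN hm) (exists_isSepUnion_depth_lt hS hN) (⌈r⌉₊ + 2)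
  choose π hπ using exists_vertexPoint_edist_le (Γ := bowditchGraph H S)
    (ℓ := bowditchLength) bowditchLength_nonneg_le_one
  refine ⟨1 + max D 0 + 1, ?_⟩
  have hceil := Nat.le_ceil r
  have := exists_cover_of_isSepUnion (K := N + 1) (r := r) (D := 1 + max D 0 + 1)
    (F := fun c => {p : Bowditch H S | π p ∈ F c})
    (fun c hc => (hF c hc).comap π (fun x hx => hx) (fun x _ y _ hxy => ?_)
      (fun x _ y _ hxy => ?_)) (fun p => hFc (π p))
  · exact_mod_cast this
  · have h1 := hπ x
    rw [edist_comm] at h1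
    refine (edist_le_ofReal_add (by positivity) zero_le_one
      (edist_le_ofReal_add zero_le_one hr.le h1 hxy) (hπ y)).trans
      (ENNReal.ofReal_le_ofReal ?_)
    push_cast
    linarith
  · have h1 := hπ y
    rw [edist_comm] at h1
    exact edist_le_ofReal_add (by positivity) zero_le_one
      (edist_le_ofReal_add zero_le_one (le_max_right _ _) (hπ x)
        (hxy.trans (ENNReal.ofReal_le_ofReal (le_max_left _ _)))) h1

end Bounds

end

end BowditchSpace

theorem proposition3p3 {G : Type*} [Group G] {n : ℕ} (H : Fin n → Subgroup G)
    (hG : BowditchSpace.IsRelHyperbolic H)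
    (S : Set G) (hS : BowditchSpace.IsCompatibleGenSet H S)
    (m : ℕ∞)
    (hm : m = ⨆ i : Fin n, BowditchSpace.lasdim
      (BowditchSpace.WordMetric ((Subtype.val : H i → G) ⁻¹' S))) :
    max (BowditchSpace.asdim (BowditchSpace.WordMetric S)) m
        ≤ BowditchSpace.asdim (BowditchSpace.Bowditch H S) ∧
      BowditchSpace.asdim (BowditchSpace.Bowditch H S)
        ≤ max (BowditchSpace.asdim (BowditchSpace.WordMetric S)) (m + 1) := by
  refine ⟨max_le (BowditchSpace.asdim_wordMetric_le hS) ?_, ?_⟩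
  · rw [hm]
    exact iSup_le (BowditchSpace.lasdim_wordMetric_subgroup_le hS)
  · rcases eq_or_ne (max (BowditchSpace.asdim (BowditchSpace.WordMetric S)) (m + 1)) ⊤ with h | h
    · rw [h]; exact le_top
    obtain ⟨N, hN⟩ := ENat.ne_top_iff_exists.1 h
    rw [← hN]
    have hmN : m + 1 ≤ N := hN ▸ le_max_right _ _
    have hmtop : m ≠ ⊤ := by
      rintro rfl
      exact h (by simp)
    obtain ⟨m', rfl⟩ := ENat.ne_top_iff_exists.1 hmtop
    refine BowditchSpace.asdim_bowditch_le hS (m := m') (hN ▸ le_max_left _ _)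
      (by exact_mod_cast hmN) fun i => ?_
    rw [hm]
    exact le_iSup (fun i => BowditchSpace.lasdim
      (BowditchSpace.WordMetric ((Subtype.val : H i → G) ⁻¹' S))) i
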